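/- Let $N\in\mathbb N$, $T>0$, and let $f:\mathbb R^N\times\mathbb R\to\mathbb R^N$ be a $C^1$-function with $f(x,t+T)=f(x,t)$ for all $x\in\mathbb R^N$, $t\in\mathbb R$. Let $x_*:\mathbb R\to\mathbb R^N$ be a $T$-periodic solution ($T$ not necessarily the minimal period) of $$\dot x(t)=f(x(t),t).$$ Let $Y_0$ be the fundamental solution of the linearization along $x_*$, i.e. $\frac{d}{dt}Y_0(t)=\partial_xf(x_*(t),t)\,Y_0(t)$, $Y_0(0)=I$. The Floquet multipliers are the complex eigenvalues of the monodromy matrix $Y_0(T)$; the algebraic multiplicity of a Floquet multiplier is its order as a zero of $z\mapsto\det(zI-Y_0(T))$. Assume that $x_*$ is non-degenerate, i.e. $1$ is not a Floquet multiplier, and that the number of real Floquet multipliers in $(1,\infty)$, counted with algebraic multiplicity, is odd. Then for every gain matrix $K\in\mathbb R^{N\times N}$, $x_*$ is unstable as a solution of the Pyragas-controlled system $$\dot x(t)=f(x(t),t)+K\,[x(t)-x(t-T)].$$ Here unstable means not Lyapunov stable in the phase space $C([-T,0],\mathbb R^N)$: there is $\varepsilon>0$ such that for every $\delta>0$ there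 are $b>0$ and a continuous $x:[-T,b)\to\mathbb R^N$ that solves the controlled system on $(0,b)$ and satisfies $\sup_{\theta\in[-T,0]}\|x(\theta)-x_*(\theta)\|<\delta$, but $\|x(t)-x_*(t)\|\ge\varepsilon$ for some $t\in[0,b)$. -/

import Mathlib

open Set

/-- The real Euclidean space `ℝ^N`. -/
abbrev RN (N : ℕ) : Type := EuclideanSpace ℝ (Fin N)

/-- `Y` solves the initial value problem `Y' = A(t) Y`, `Y(0) = I`. -/
structure IsFundamentalSolution {N : ℕ} (A Y : ℝ → RN N →L[ℝ] RN N) : Prop where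
  init : Y 0 = ContinuousLinearMap.id ℝ (RN N)
  deriv : ∀ t : ℝ, HasDerivAt Y (A t ∘L Y t) t

/-- The fundamental solution of `y' = A(t) y`. For continuous `A` it exists and is unique, see
`fundamentalSolution_spec` and `IsFundamentalSolution.eq_fundamentalSolution`. -/
noncomputable def fundamentalSolution {N : ℕ} (A : ℝ → RN N →L[ℝ] RN N) :
    ℝ → RN N →L[ℝ] RN N :=
  Classical.epsilon (IsFundamentalSolution A)

/-- The iterated integrals of the Peano-Baker series, used only to prove existence of the
fundamental solution. -/
noncomputable def peanoBakerTerm {N : ℕ} (A : ℝ → RN N →L[ℝ] RN N) :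
    ℕ → ℝ → RN N →L[ℝ] RN N
  | 0 => fun _ => ContinuousLinearMap.id ℝ (RN N)
  | n + 1 => fun t => ∫ s in (0 : ℝ)..t, A s ∘L peanoBakerTerm A n s

theorem peanoBakerTerm_hasDerivAt {N : ℕ} {A : ℝ → RN N →L[ℝ] RN N} (hA : Continuous A) (n : ℕ) :
    Continuous (peanoBakerTerm A n) ∧
      ∀ t, HasDerivAt (peanoBakerTerm A (n + 1)) (A t ∘L peanoBakerTerm A n t) t := by
  have key : ∀ n, Continuous (peanoBakerTerm A n) →
      ∀ t, HasDerivAt (peanoBakerTerm A (n + 1)) (A t ∘L peanoBakerTerm A n t) t := by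
    intro n h t
    have hc : Continuous (fun s => A s ∘L peanoBakerTerm A n s) := hA.clm_comp h
    exact intervalIntegral.integral_hasDerivAt_right (hc.intervalIntegrable _ _)
      (hc.stronglyMeasurableAtFilter _ _) hc.continuousAt
  have hcont : Continuous (peanoBakerTerm A n) := by
    induction n with
    | zero => exact continuous_const
    | succ n ih => exact continuous_iff_continuousAt.2 fun t => (key n ih t).continuousAt
  exact ⟨hcont, key n hcont⟩

theorem peanoBakerTerm_norm_le {N : ℕ} {A : ℝ → RN N →L[ℝ] RN N} {R M : ℝ}
    (hM : ∀ t, |t| ≤ R → ‖A t‖ ≤ M) (n : ℕ) :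
    ∀ t, |t| ≤ R → ‖peanoBakerTerm A n t‖ ≤ (M * |t|) ^ n / n.factorial := by
  induction n with
  | zero =>
    intro t _
    simpa [peanoBakerTerm] using ContinuousLinearMap.norm_id_le
  | succ n ih =>
    intro t ht
    have hM0 : 0 ≤ M := (norm_nonneg _).trans (hM t ht)
    have hb : ∀ s, |s| ≤ R →
        ‖A s ∘L peanoBakerTerm A n s‖ ≤ M * ((M * |s|) ^ n / n.factorial) := fun s hs =>
      (ContinuousLinearMap.opNorm_comp_le _ _).trans
        (mul_le_mul (hM s hs) (ih s hs) (norm_nonneg _) hM0)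
    have hI : ∀ u : ℝ, 0 ≤ u →
        ∫ s in (0 : ℝ)..u, M * ((M * s) ^ n / n.factorial) =
          (M * u) ^ (n + 1) / (n + 1).factorial := by
      intro u _
      have : ∀ s : ℝ, M * ((M * s) ^ n / n.factorial) = (M ^ (n + 1) / n.factorial) * s ^ n := by
        intro s; rw [mul_pow]; ring
      simp only [this, intervalIntegral.integral_const_mul, integral_pow]
      have hn : (n.factorial : ℝ) ≠ 0 := by positivity
      rw [Nat.factorial_succ]
      push_cast
      field_simp
      ring
    rcases le_total 0 t with h0 | h0
    · rw [abs_of_nonneg h0, ← hI t h0]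
      refine intervalIntegral.norm_integral_le_of_norm_le h0 (Filter.Eventually.of_forall ?_) ?_
      · intro s hs
        have := hb s (by rw [abs_of_pos hs.1]; rw [abs_of_nonneg h0] at ht; linarith [hs.2])
        rwa [abs_of_pos hs.1] at this
      · exact Continuous.intervalIntegrable (by fun_prop) _ _
    · have e : peanoBakerTerm A (n + 1) t
          = -∫ s in (0 : ℝ)..(-t), A (-s) ∘L peanoBakerTerm A n (-s) := by
        rw [intervalIntegral.integral_comp_neg (fun s => A s ∘L peanoBakerTerm A n s)]
        simp [peanoBakerTerm, intervalIntegral.integral_symm t 0]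
      rw [abs_of_nonpos h0, ← hI (-t) (by linarith), e, norm_neg]
      refine intervalIntegral.norm_integral_le_of_norm_le (by linarith)
        (Filter.Eventually.of_forall ?_) ?_
      · intro s hs
        have := hb (-s) (by
          rw [abs_neg, abs_of_pos hs.1]; rw [abs_of_nonpos h0] at ht; linarith [hs.2])
        rwa [abs_neg, abs_of_pos hs.1] at this
      · exact Continuous.intervalIntegrable (by fun_prop) _ _

theorem exists_isFundamentalSolution {N : ℕ} {A : ℝ → RN N →L[ℝ] RN N} (hA : Continuous A) :
    ∃ Y, IsFundamentalSolution A Y := by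
  refine ⟨fun t => peanoBakerTerm A 0 t + ∑' n, peanoBakerTerm A (n + 1) t, ?_, ?_⟩
  · simp [peanoBakerTerm]
  · intro t
    set R : ℝ := |t| + 1 with hR
    obtain ⟨M, hM⟩ := (isCompact_Icc (a := -R) (b := R)).exists_bound_of_continuousOn
      hA.continuousOn
    have hM' : ∀ s, |s| ≤ R → ‖A s‖ ≤ M := fun s hs => hM s (abs_le.1 hs)
    have hR0 : 0 ≤ R := by positivity
    have hM0 : 0 ≤ M := (norm_nonneg _).trans (hM' 0 (by simpa using hR0))
    have hnb : ∀ n s, |s| ≤ R → ‖peanoBakerTerm A n s‖ ≤ (M * R) ^ n / n.factorial := by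
      intro n s hs
      refine (peanoBakerTerm_norm_le hM' n s hs).trans ?_
      gcongr
    have hsum : Summable fun n : ℕ => (M * R) ^ n / n.factorial :=
      Real.summable_pow_div_factorial _
    have hs : ∀ s, |s| ≤ R → Summable fun n => peanoBakerTerm A n s := fun s hs =>
      Summable.of_norm_bounded hsum (fun n => hnb n s hs)
    have h0sum : Summable fun n => peanoBakerTerm A (n + 1) 0 :=
      Summable.of_norm_bounded ((summable_nat_add_iff 1).2 hsum)
        (fun n => hnb (n + 1) 0 (by rw [abs_zero]; exact hR0))
    have hd := hasDerivAt_tsum_of_isPreconnected (𝕜 := ℝ)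
      (g := fun n => peanoBakerTerm A (n + 1))
      (g' := fun n s => A s ∘L peanoBakerTerm A n s)
      (u := fun n : ℕ => M * ((M * R) ^ n / n.factorial)) (t := Ioo (-R) R) (y₀ := 0) (y := t)
      (hsum.mul_left M) isOpen_Ioo isPreconnected_Ioo
      (fun n s _ => (peanoBakerTerm_hasDerivAt hA n).2 s)
      (fun n s hs => by
        have hs' : |s| ≤ R := abs_le.2 ⟨hs.1.le, hs.2.le⟩
        exact (ContinuousLinearMap.opNorm_comp_le _ _).trans
          (mul_le_mul (hM' s hs') (hnb n s hs') (norm_nonneg _) hM0))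
      (by constructor <;> [linarith [abs_nonneg t]; linarith [abs_nonneg t]])
      h0sum
      (abs_lt.1 (by linarith))
    have hst := hs t (by linarith)
    have e : ∑' n, A t ∘L peanoBakerTerm A n t =
        A t ∘L (peanoBakerTerm A 0 t + ∑' n, peanoBakerTerm A (n + 1) t) := by
      rw [← hst.tsum_eq_zero_add]
      exact ((ContinuousLinearMap.compL ℝ (RN N) (RN N) (RN N) (A t)).map_tsum hst).symm
    rw [← e]
    exact hd.const_add _

theorem fundamentalSolution_spec {N : ℕ} {A : ℝ → RN N →L[ℝ] RN N} (hA : Continuous A) :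
    IsFundamentalSolution A (fundamentalSolution A) :=
  Classical.epsilon_spec (exists_isFundamentalSolution hA)

theorem IsFundamentalSolution.eq_fundamentalSolution {N : ℕ} {A Y : ℝ → RN N →L[ℝ] RN N}
    (hA : Continuous A) (hY : IsFundamentalSolution A Y) : Y = fundamentalSolution A := by
  have hZ := fundamentalSolution_spec hA
  set Z := fundamentalSolution A with hZdef
  funext t
  set R : ℝ := |t| + 1 with hR
  obtain ⟨M, hM⟩ := (isCompact_Icc (a := -R) (b := R)).exists_bound_of_continuousOn
    hA.continuousOn
  have hLip : ∀ s ∈ Ioo (-R) R, LipschitzOnWith (Real.toNNReal M)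
      (fun B : RN N →L[ℝ] RN N => A s ∘L B) univ := by
    intro s hs
    refine LipschitzOnWith.of_dist_le_mul fun B _ C _ => ?_
    rw [dist_eq_norm, dist_eq_norm, ← ContinuousLinearMap.comp_sub]
    refine (ContinuousLinearMap.opNorm_comp_le _ _).trans ?_
    have := (hM s ⟨hs.1.le, hs.2.le⟩).trans (Real.le_coe_toNNReal M)
    gcongr
  have h0 : (0 : ℝ) ∈ Ioo (-R) R := by constructor <;> linarith [abs_nonneg t]
  exact ODE_solution_unique_of_mem_Ioo (v := fun s B => A s ∘L B) (s := fun _ => univ) hLip h0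
    (fun s _ => ⟨hY.deriv s, mem_univ _⟩) (fun s _ => ⟨hZ.deriv s, mem_univ _⟩)
    (hY.init.trans hZ.init.symm) (abs_lt.1 (by linarith))

/-- The monodromy operator `Y(T)` of `y' = A(t) y`. -/
noncomputable def monodromy {N : ℕ} (A : ℝ → RN N →L[ℝ] RN N) (T : ℝ) : RN N →L[ℝ] RN N :=
  fundamentalSolution A T

/-- The Floquet multipliers of the `T`-periodic system `y' = A(t) y`: the complex eigenvalues of
the monodromy operator, i.e. the complex zeros of `z ↦ det (z I - Y(T))`, each repeated according
to its algebraic multiplicity. -/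
noncomputable def floquetMultipliers {N : ℕ} (A : ℝ → RN N →L[ℝ] RN N) (T : ℝ) : Multiset ℂ :=
  ((monodromy A T : RN N →ₗ[ℝ] RN N).charpoly.map (algebraMap ℝ ℂ)).roots

open Classical in
/-- The number, with algebraic multiplicities, of Floquet multipliers that are real and `> 1`. -/
noncomputable def numRealMultipliersGtOne {N : ℕ} (A : ℝ → RN N →L[ℝ] RN N) (T : ℝ) : ℕ :=
  ((floquetMultipliers A T).filter (fun μ : ℂ => ∃ r : ℝ, 1 < r ∧ μ = (r : ℂ))).card

/-- The coefficient `t ↦ ∂ₓf(x⋆(t), t)` of the linearization of `x' = f(x, t)` along `x⋆`. -/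
noncomputable def linearization {N : ℕ} (f : RN N → ℝ → RN N) (xs : ℝ → RN N) :
    ℝ → RN N →L[ℝ] RN N :=
  fun t => fderiv ℝ (fun x => f x t) (xs t)

/-- `x⋆` is non-degenerate: the linearization along it does not have the Floquet multiplier `1`. -/
def IsNondegenerate {N : ℕ} (f : RN N → ℝ → RN N) (T : ℝ) (xs : ℝ → RN N) : Prop :=
  (1 : ℂ) ∉ floquetMultipliers (linearization f xs) T

/-- `x : [-T, b) → ℝ^N` is a solution, with a continuous initial history on `[-T, 0]`, of the
Pyragas controlled system `x'(t) = f(x(t), t) + K (x(t) - x(t - T))`. (Values of `x` outside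
`[-T, b)` are irrelevant.) -/
structure IsPyragasSolution {N : ℕ} (f : RN N → ℝ → RN N) (K : Matrix (Fin N) (Fin N) ℝ)
    (T b : ℝ) (x : ℝ → RN N) : Prop where
  continuousOn : ContinuousOn x (Ico (-T) b)
  deriv : ∀ t ∈ Ioo 0 b,
    HasDerivAt x (f (x t) t + Matrix.toEuclideanCLM (𝕜 := ℝ) K (x t - x (t - T))) t

/-- Lyapunov stability of `x⋆` as a solution of the Pyragas controlled system, in the phase space
`C([-T, 0], ℝ^N)` with the sup norm and with initial time `0`. A solution that stays `ε`-close to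
the bounded function `x⋆` as long as it exists can be continued to `[-T, ∞)`, so that global
existence need not be demanded separately. -/
def IsPyragasStable {N : ℕ} (f : RN N → ℝ → RN N) (K : Matrix (Fin N) (Fin N) ℝ) (T : ℝ)
    (xs : ℝ → RN N) : Prop :=
  ∀ ε > 0, ∃ δ > 0, ∀ b > 0, ∀ x : ℝ → RN N, IsPyragasSolution f K T b x →
    (∀ θ ∈ Icc (-T) 0, ‖x θ - xs θ‖ < δ) → ∀ t ∈ Ico 0 b, ‖x t - xs t‖ < ε

/-- `x⋆` is unstable: it is not Lyapunov stable. -/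
def IsPyragasUnstable {N : ℕ} (f : RN N → ℝ → RN N) (K : Matrix (Fin N) (Fin N) ℝ) (T : ℝ)
    (xs : ℝ → RN N) : Prop :=
  ¬ IsPyragasStable f K T xs

/-! Let `A` be the linearization and `Y κ` the fundamental solution of `y' = (A + κK) y`. If a
solution of the linearized controlled system satisfies `y(t - T) = ω y(t)`, the control term becomes
`(1 - ω) K y`; such solutions correspond to zeros of `D(ω) = det (1 - ω Y (1 - ω) T)`. Here `D(0) =
1`, while at `ω = 1` the gain drops out and `D(1) = det (1 - Y₀(T))` is the product of the `1 - μ`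
over the Floquet multipliers, which is negative by the parity hypothesis. Hence `D` has a zero in
`(0, 1)`, a growth factor `1/ω > 1` per period, whatever `K` is (`exists_characteristic_zero`).

Passing to the nonlinear system uses no invariant manifolds. Let `y` be the deviation from the orbit
and `g` its nonlinear remainder, `‖g‖ ≤ η ‖y‖` near the orbit. The generating function `X_w(t) =
∑_{n<M} w^n y(t + nT)` solves the ordinary differential equation with coefficient `A + (1 - w) K`,
up to forcing by `g`, the history and the last period; moreover `(1 - w Y (1 - w) T) X_w(0) = y(0) -
w^M y(MT) + w z`, with `z` the effect of the forcing (`genFun_sub_fundamental`). At `w = ω` pair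
this with a unit vector `l` orthogonal to the range of the operator: the left side vanishes. With
history `σ e^{mt} l` the right side is at least `σ - σ/4 - σ/2`, a contradiction
(`exists_unbounded_direction`).

To bound `z`, choose `R` in `(ω, 1)` such that the operator is invertible on the circle `|w| = R`.
Parseval on that circle gives a weighted `L²` bound of `y` by `g` and the data
(`exists_weightedSq_bound`). Since `g` is small relative to `y`, it is absorbed, and Cauchy-Schwarz
descends from `R` to `ω`. -/

/-! ### Existence and growth bounds for ordinary differential equations. -/

/-- A nonautonomous ODE whose right-hand side is continuous and Lipschitz in the state variable,
uniformly on `[0, b]`, has a solution on all of `[0, b]`. -/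
theorem exists_solution_of_lipschitz {F : Type*} [NormedAddCommGroup F] [NormedSpace ℝ F]
    [CompleteSpace F] {v : ℝ → F → F} (hv : Continuous (Function.uncurry v)) {b L : ℝ}
    (hb : 0 ≤ b) (hL : 0 ≤ L)
    (hlip : ∀ t ∈ Icc 0 b, ∀ x y, ‖v t x - v t y‖ ≤ L * ‖x - y‖) (x₀ : F) :
    ∃ y : ℝ → F, Continuous y ∧ y 0 = x₀ ∧ ∀ t ∈ Icc 0 b, HasDerivAt y (v t (y t)) t := by
  -- In the unknown `e^{-lam t} y(t)` the Picard map has Lipschitz constant `L / lam ≤ 1/2`, so one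
  -- fixed point covers all of `[0, b]`; the `+ 1` keeps `lam` positive when `L = 0`.
  set lam : ℝ := 2 * L + 1 with hlam
  have hlam0 : 0 < lam := by positivity
  -- Extending past the interval makes `P u` differentiable on all of `ℝ`, hence two-sided
  -- derivatives at the endpoints of `[0, b]`.
  let ext : C(Icc (0 : ℝ) b, F) → ℝ → F := fun u s => Real.exp (lam * s) • IccExtend hb u s
  have hext : ∀ u, Continuous (ext u) := fun u => by
    have : Continuous (IccExtend hb u) := u.continuous.Icc_extend'
    fun_prop
  have hcomp : ∀ u, Continuous fun s => v s (ext u s) := fun u =>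
    hv.comp (continuous_id.prodMk (hext u))
  let P : C(Icc (0 : ℝ) b, F) → ℝ → F := fun u t => x₀ + ∫ s in (0 : ℝ)..t, v s (ext u s)
  have hP : ∀ u t, HasDerivAt (P u) (v t (ext u t)) t := fun u t =>
    (intervalIntegral.integral_hasDerivAt_right ((hcomp u).intervalIntegrable _ _)
      ((hcomp u).stronglyMeasurableAtFilter _ _) (hcomp u).continuousAt).const_add _
  have hPc : ∀ u, Continuous (P u) := fun u =>
    continuous_iff_continuousAt.2 fun t => (hP u t).continuousAt
  let Ψ : C(Icc (0 : ℝ) b, F) → C(Icc (0 : ℝ) b, F) := fun u =>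
    ⟨fun t => Real.exp (-(lam * t)) • P u t, by
      have := hPc u
      fun_prop⟩
  have hcontr : ContractingWith (1 / 2) Ψ := by
    refine ⟨by norm_num, LipschitzWith.of_dist_le_mul fun u w => ?_⟩
    refine (ContinuousMap.dist_le (by positivity)).2 fun t => ?_
    have ht := t.2
    have h1 : ‖P u t - P w t‖ ≤ ∫ s in (0 : ℝ)..t, L * dist u w * Real.exp (lam * s) := by
      have e : P u t - P w t = ∫ s in (0 : ℝ)..t, (v s (ext u s) - v s (ext w s)) := by
        rw [intervalIntegral.integral_sub ((hcomp u).intervalIntegrable _ _)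
          ((hcomp w).intervalIntegrable _ _)]
        simp only [P]; abel
      rw [e]
      refine intervalIntegral.norm_integral_le_of_norm_le ht.1
        (Filter.Eventually.of_forall fun s hs => ?_) (Continuous.intervalIntegrable (by fun_prop) _ _)
      have hs' : s ∈ Icc 0 b := ⟨hs.1.le, hs.2.trans ht.2⟩
      refine (hlip s hs' _ _).trans ?_
      have : ‖ext u s - ext w s‖ ≤ Real.exp (lam * s) * dist u w := by
        simp only [ext]
        rw [← smul_sub, norm_smul, Real.norm_of_nonneg (Real.exp_nonneg _), ← dist_eq_norm]
        exact mul_le_mul_of_nonneg_left (ContinuousMap.dist_apply_le_dist _) (Real.exp_nonneg _)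
      calc L * ‖ext u s - ext w s‖ ≤ L * (Real.exp (lam * s) * dist u w) := by gcongr
        _ = _ := by ring
    have h2 : ∫ s in (0 : ℝ)..t, L * dist u w * Real.exp (lam * s)
        = L * dist u w * ((Real.exp (lam * t) - 1) / lam) := by
      simp [intervalIntegral.integral_comp_mul_left Real.exp hlam0.ne', integral_exp]
      left; ring
    change dist (Real.exp (-(lam * t)) • P u t) (Real.exp (-(lam * t)) • P w t) ≤ _
    rw [dist_eq_norm, ← smul_sub, norm_smul, Real.norm_of_nonneg (Real.exp_nonneg _)]
    have hd : 0 ≤ dist u w := dist_nonneg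
    have h3 : Real.exp (-(lam * t)) * Real.exp (lam * t) = 1 := by
      rw [← Real.exp_add]; simp
    calc Real.exp (-(lam * t)) * ‖P u t - P w t‖
        ≤ Real.exp (-(lam * t)) * (L * dist u w * (Real.exp (lam * t) / lam)) := by
          gcongr
          rw [h2] at h1
          refine h1.trans ?_
          gcongr
          linarith
      _ = (L / lam) * dist u w := by
          rw [show Real.exp (-(lam * t)) * (L * dist u w * (Real.exp (lam * t) / lam))
            = (Real.exp (-(lam * t)) * Real.exp (lam * t)) * (L / lam * dist u w) by ring, h3,
            one_mul]
      _ ≤ _ := by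
          refine mul_le_mul_of_nonneg_right ?_ hd
          rw [div_le_iff₀ hlam0]
          push_cast
          linarith
  obtain ⟨u, hu⟩ : ∃ u, Ψ u = u := ⟨_, hcontr.fixedPoint_isFixedPt⟩
  have key : ∀ t ∈ Icc 0 b, ext u t = P u t := by
    intro t ht
    have : u ⟨t, ht⟩ = Real.exp (-(lam * t)) • P u t := by
      conv_lhs => rw [← hu]
      rfl
    simp only [ext, IccExtend_of_mem hb u ht, this, smul_smul, ← Real.exp_add]
    simp
  refine ⟨P u, hPc u, by simp [P], fun t ht => ?_⟩
  rw [← key t ht]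
  exact hP u t

/-- Gronwall with zero initial value. The bound is proportional to the source `e`, so it turns small
sources into rates of dependence on a parameter. -/
theorem norm_le_of_linear_deriv {F : Type*} [NormedAddCommGroup F] [NormedSpace ℝ F]
    {y y' : ℝ → F} {b c e : ℝ} (hc : 0 < c) (he : 0 ≤ e) (hy : ∀ t ∈ Icc 0 b, HasDerivAt y (y' t) t)
    (h0 : y 0 = 0) (hbd : ∀ t ∈ Icc 0 b, ‖y' t‖ ≤ c * ‖y t‖ + e) :
    ∀ t ∈ Icc 0 b, ‖y t‖ ≤ e * (Real.exp (c * b) / c) := by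
  intro t ht
  have := norm_le_gronwallBound_of_norm_deriv_right_le (f := y) (f' := y') (δ := 0) (K := c)
    (ε := e) (a := 0) (b := b) (fun s hs => (hy s hs).continuousAt.continuousWithinAt)
    (fun s hs => (hy s ⟨hs.1, hs.2.le⟩).hasDerivWithinAt) (by simp [h0])
    (fun s hs => hbd s ⟨hs.1, hs.2.le⟩) t ht
  rw [gronwallBound_of_K_ne_0 hc.ne'] at this
  refine this.trans ?_
  have h1 : Real.exp (c * (t - 0)) ≤ Real.exp (c * b) := by
    gcongr; linarith [ht.2]
  calc _ = e / c * (Real.exp (c * (t - 0)) - 1) := by simp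
    _ ≤ e / c * Real.exp (c * b) := by gcongr; linarith
    _ = _ := by ring

/-! ### Dependence of fundamental solutions on the parameter. -/

/-- Parametrised fundamental solutions `Y' = (A(t) + κ K) Y`, `Y(0) = 1` on `[0, b]`. -/
structure IsFundamentalFamily {𝕜 𝔸 : Type*} [RCLike 𝕜] [NormedRing 𝔸] [NormedAlgebra 𝕜 𝔸]
    [NormedSpace ℝ 𝔸] (A : ℝ → 𝔸) (K : 𝔸) (b : ℝ) (Y : 𝕜 → ℝ → 𝔸) : Prop where
  init : ∀ κ, Y κ 0 = 1
  continuous : ∀ κ, Continuous (Y κ)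
  deriv : ∀ κ, ∀ t ∈ Icc 0 b, HasDerivAt (Y κ) ((A t + κ • K) * Y κ t) t

section FundamentalFamily

variable {𝕜 𝔸 : Type*} [RCLike 𝕜] [NormedRing 𝔸] [NormedAlgebra 𝕜 𝔸] [NormedSpace ℝ 𝔸]
  {A : ℝ → 𝔸} {K : 𝔸} {b : ℝ} {Y : 𝕜 → ℝ → 𝔸}

theorem exists_linear_solution [CompleteSpace 𝔸] {B g : ℝ → 𝔸} (hB : Continuous B) (hg : Continuous g) (hb : 0 ≤ b)
    (x₀ : 𝔸) : ∃ y : ℝ → 𝔸, Continuous y ∧ y 0 = x₀ ∧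
      ∀ t ∈ Icc 0 b, HasDerivAt y (B t * y t + g t) t := by
  obtain ⟨L, hL⟩ := (isCompact_Icc (a := 0) (b := b)).exists_bound_of_continuousOn hB.continuousOn
  have hL0 : 0 ≤ L := (norm_nonneg _).trans (hL 0 ⟨le_rfl, hb⟩)
  refine exists_solution_of_lipschitz (v := fun t y => B t * y + g t)
    (by simp only [Function.uncurry_def]; fun_prop) hb hL0 (fun t ht x y => ?_) x₀
  rw [add_sub_add_right_eq_sub, ← mul_sub]
  exact (norm_mul_le _ _).trans (mul_le_mul_of_nonneg_right (hL t ht) (norm_nonneg _))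

theorem exists_isFundamentalFamily [CompleteSpace 𝔸] (hA : Continuous A) (hb : 0 ≤ b) (K : 𝔸) :
    ∃ Y : 𝕜 → ℝ → 𝔸, IsFundamentalFamily A K b Y := by
  have h : ∀ κ : 𝕜, ∃ y : ℝ → 𝔸, Continuous y ∧ y 0 = 1 ∧
      ∀ t ∈ Icc 0 b, HasDerivAt y ((A t + κ • K) * y t) t := fun κ => by
    simpa using exists_linear_solution (B := fun t => A t + κ • K) (g := fun _ => 0)
      (by fun_prop) continuous_const hb (1 : 𝔸)
  choose Y hY using h
  exact ⟨Y, fun κ => (hY κ).2.1, fun κ => (hY κ).1, fun κ => (hY κ).2.2⟩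

/-- The difference solves the equation at `κ + h` with source `h K Y κ` and starts at zero. The
restriction `‖h‖ ≤ 1` makes the Gronwall constant independent of `h`. -/
theorem IsFundamentalFamily.norm_sub_le (hY : IsFundamentalFamily A K b Y) (hA : Continuous A)
    (hb : 0 ≤ b) (κ : 𝕜) : ∃ C, 0 ≤ C ∧ ∀ h : 𝕜, ‖h‖ ≤ 1 → ∀ t ∈ Icc 0 b,
      ‖Y (κ + h) t - Y κ t‖ ≤ C * ‖h‖ := by
  obtain ⟨a, ha⟩ := (isCompact_Icc (a := 0) (b := b)).exists_bound_of_continuousOn hA.continuousOn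
  obtain ⟨m, hm⟩ := (isCompact_Icc (a := 0) (b := b)).exists_bound_of_continuousOn
    (hY.continuous κ).continuousOn
  have ha0 : 0 ≤ a := (norm_nonneg _).trans (ha 0 ⟨le_rfl, hb⟩)
  have hm0 : 0 ≤ m := (norm_nonneg _).trans (hm 0 ⟨le_rfl, hb⟩)
  set c : ℝ := a + (‖κ‖ + 1) * ‖K‖ + 1 with hc
  have hc0 : 0 < c := by positivity
  refine ⟨‖K‖ * m * (Real.exp (c * b) / c), by positivity, fun h hh t ht => ?_⟩
  have := norm_le_of_linear_deriv (y := fun t => Y (κ + h) t - Y κ t)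
    (y' := fun t => (A t + (κ + h) • K) * Y (κ + h) t - (A t + κ • K) * Y κ t)
    (e := ‖h‖ * (‖K‖ * m)) hc0 (by positivity)
    (fun t ht => (hY.deriv _ t ht).sub (hY.deriv _ t ht)) (by simp [hY.init]) (fun t ht => ?_) t ht
  · refine this.trans (le_of_eq (by ring))
  · have e : (A t + (κ + h) • K) * Y (κ + h) t - (A t + κ • K) * Y κ t
        = (A t + (κ + h) • K) * (Y (κ + h) t - Y κ t) + h • (K * Y κ t) := by
      simp only [add_smul, add_mul, mul_sub, smul_mul_assoc]; abel
    rw [e]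
    refine (norm_add_le _ _).trans (add_le_add ((norm_mul_le _ _).trans ?_) ?_)
    · refine mul_le_mul_of_nonneg_right ((norm_add_le _ _).trans ?_) (norm_nonneg _)
      have h1 : ‖(κ + h) • K‖ ≤ (‖κ‖ + 1) * ‖K‖ := by
        rw [norm_smul]
        gcongr
        exact (norm_add_le _ _).trans (by gcongr)
      have := ha t ht
      rw [hc]; linarith
    · rw [norm_smul]
      gcongr
      exact (norm_mul_le _ _).trans (by gcongr; exact hm t ht)

theorem IsFundamentalFamily.continuous_param (hY : IsFundamentalFamily A K b Y) (hA : Continuous A)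
    (hb : 0 ≤ b) : Continuous fun κ => Y κ b := by
  refine continuous_iff_continuousAt.2 fun κ => ?_
  obtain ⟨C, hC0, hC⟩ := hY.norm_sub_le hA hb κ
  refine Metric.continuousAt_iff.2 fun ε hε => ⟨min 1 (ε / (C + 1)), by positivity, fun x hx => ?_⟩
  rw [dist_eq_norm] at hx ⊢
  have h1 : ‖x - κ‖ ≤ 1 := hx.le.trans (min_le_left _ _)
  have h2 : ‖x - κ‖ < ε / (C + 1) := hx.trans_le (min_le_right _ _)
  have := hC (x - κ) h1 b ⟨hb, le_rfl⟩
  rw [add_sub_cancel] at this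
  rw [lt_div_iff₀ (by positivity)] at h2
  nlinarith [norm_nonneg (x - κ)]

theorem IsFundamentalFamily.norm_le (hY : IsFundamentalFamily A K b Y) (hA : Continuous A)
    (hb : 0 ≤ b) (r : ℝ) (hr : 0 ≤ r) : ∃ C, 0 ≤ C ∧ ∀ κ : 𝕜, ‖κ‖ ≤ r → ∀ t ∈ Icc 0 b,
      ‖Y κ t‖ ≤ C := by
  obtain ⟨a, ha⟩ := (isCompact_Icc (a := 0) (b := b)).exists_bound_of_continuousOn hA.continuousOn
  have ha0 : 0 ≤ a := (norm_nonneg _).trans (ha 0 ⟨le_rfl, hb⟩)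
  set c : ℝ := a + r * ‖K‖ + 1 with hc
  have hc0 : 0 < c := by positivity
  refine ⟨c * ‖(1 : 𝔸)‖ * (Real.exp (c * b) / c) + ‖(1 : 𝔸)‖, by positivity,
    fun κ hκ t ht => ?_⟩
  have hB : ∀ t ∈ Icc 0 b, ‖A t + κ • K‖ ≤ c := fun t ht => by
    have h1 : ‖κ • K‖ ≤ r * ‖K‖ := by rw [norm_smul]; gcongr
    have := (norm_add_le (A t) (κ • K)).trans (add_le_add (ha t ht) h1)
    linarith
  -- Subtracting `1` makes the initial value zero, at the price of the source `(A + κK) 1`.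
  have := norm_le_of_linear_deriv (y := fun t => Y κ t - 1)
    (y' := fun t => (A t + κ • K) * Y κ t) (e := c * ‖(1 : 𝔸)‖) hc0 (by positivity)
    (fun t ht => (hY.deriv _ t ht).sub_const _) (by simp [hY.init]) (fun t ht => ?_) t ht
  · have h2 := norm_add_le (Y κ t - 1) 1
    rw [sub_add_cancel] at h2
    linarith
  · have e : (A t + κ • K) * Y κ t = (A t + κ • K) * (Y κ t - 1) + (A t + κ • K) * 1 := by
      rw [← mul_add, sub_add_cancel]
    rw [e]
    exact (norm_add_le _ _).trans (add_le_add
      ((norm_mul_le _ _).trans (mul_le_mul_of_nonneg_right (hB t ht) (norm_nonneg _)))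
      ((norm_mul_le _ _).trans (mul_le_mul_of_nonneg_right (hB t ht) (norm_nonneg _))))

/-- The derivative `D` solves the formally differentiated equation. The remainder then has source `h
K (Y (κ + h) - Y κ)`, already quadratic in `h`. Over `ℂ` this makes the family entire. -/
theorem IsFundamentalFamily.differentiable_param [CompleteSpace 𝔸] [SMulCommClass ℝ 𝕜 𝔸]
    (hY : IsFundamentalFamily A K b Y) (hA : Continuous A) (hb : 0 ≤ b) :
    Differentiable 𝕜 fun κ => Y κ b := by
  intro κ
  obtain ⟨D, -, hD0, hD⟩ := exists_linear_solution (B := fun t => A t + κ • K)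
    (g := fun t => K * Y κ t) (by fun_prop) (continuous_const.mul (hY.continuous κ)) hb (0 : 𝔸)
  obtain ⟨C, hC0, hC⟩ := hY.norm_sub_le hA hb κ
  obtain ⟨a, ha⟩ := (isCompact_Icc (a := 0) (b := b)).exists_bound_of_continuousOn hA.continuousOn
  have ha0 : 0 ≤ a := (norm_nonneg _).trans (ha 0 ⟨le_rfl, hb⟩)
  set c : ℝ := a + ‖κ‖ * ‖K‖ + 1 with hc
  have hc0 : 0 < c := by positivity
  set C' : ℝ := ‖K‖ * C * (Real.exp (c * b) / c) with hC'
  have hC'0 : 0 ≤ C' := by positivity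
  have key : ∀ h : 𝕜, ‖h‖ ≤ 1 → ‖Y (κ + h) b - Y κ b - h • D b‖ ≤ C' * ‖h‖ ^ 2 := by
    intro h hh
    have := norm_le_of_linear_deriv (y := fun t => Y (κ + h) t - Y κ t - h • D t)
      (y' := fun t => (A t + (κ + h) • K) * Y (κ + h) t - (A t + κ • K) * Y κ t
        - h • ((A t + κ • K) * D t + K * Y κ t))
      (e := ‖h‖ * (‖K‖ * (C * ‖h‖))) hc0 (by positivity)
      (fun t ht => ((hY.deriv _ t ht).sub (hY.deriv _ t ht)).sub ((hD t ht).const_smul h))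
      (by simp [hY.init, hD0]) (fun t ht => ?_) b ⟨hb, le_rfl⟩
    · refine this.trans (le_of_eq (by rw [hC']; ring))
    · have e : (A t + (κ + h) • K) * Y (κ + h) t - (A t + κ • K) * Y κ t
          - h • ((A t + κ • K) * D t + K * Y κ t)
          = (A t + κ • K) * (Y (κ + h) t - Y κ t - h • D t) + h • (K * (Y (κ + h) t - Y κ t)) := by
        simp only [add_smul, add_mul, mul_sub, smul_mul_assoc, smul_add, smul_sub, mul_smul_comm]
        rw [smul_comm h κ]
        abel
      rw [e]
      refine (norm_add_le _ _).trans (add_le_add ((norm_mul_le _ _).trans ?_) ?_)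
      · refine mul_le_mul_of_nonneg_right ((norm_add_le _ _).trans ?_) (norm_nonneg _)
        rw [norm_smul, hc]
        linarith [ha t ht]
      · rw [norm_smul]
        gcongr
        exact (norm_mul_le _ _).trans (by gcongr; exact hC h hh t ht)
  refine HasDerivAt.differentiableAt (f' := D b) ?_
  rw [hasDerivAt_iff_isLittleO_nhds_zero]
  refine Asymptotics.IsBigO.trans_isLittleO (g := fun h : 𝕜 => ‖h‖ ^ 2) ?_ ?_
  · refine Asymptotics.IsBigO.of_bound C' ?_
    filter_upwards [Metric.closedBall_mem_nhds (0 : 𝕜) one_pos] with h hh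
    have := key h (by simpa using hh)
    simpa using this
  · exact Asymptotics.IsLittleO.of_norm_right (by
      simpa using (Asymptotics.isLittleO_norm_pow_id (E' := 𝕜) (n := 2) one_lt_two).norm_right)

end FundamentalFamily

/-! ### Parity of the multipliers and the sign of the determinant. -/

open Polynomial in
/-- A monic real polynomial without root at `1` whose number of roots in `(1, ∞)`, counted with
multiplicity, is odd, is negative at `1`. -/
theorem eval_one_neg_of_odd_roots {p : ℝ[X]} (hp : p.Monic)
    (h1 : (1 : ℂ) ∉ (p.map (algebraMap ℝ ℂ)).roots)
    (hodd : Odd (Multiset.card (p.roots.filter (fun r => 1 < r)))) : p.eval 1 < 0 := by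
  obtain ⟨q, hq, -, hq0⟩ := exists_prod_multiset_X_sub_C_mul p
  have hp0 : p ≠ 0 := hp.ne_zero
  have h1' : (1 : ℝ) ∉ p.roots := by
    intro h
    apply h1
    have h2 := (mem_roots hp0).1 h
    have : (p.map (algebraMap ℝ ℂ)) ≠ 0 := (hp.map _).ne_zero
    rw [mem_roots this]
    have := h2.map (f := algebraMap ℝ ℂ)
    simpa using this
  have hqm : q.Monic := by
    have hm : (p.roots.map fun a => X - C a).prod.Monic :=
      monic_multiset_prod_of_monic _ _ fun a _ => monic_X_sub_C a
    exact hm.of_mul_monic_left (by rw [hq]; exact hp)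
  -- The cofactor `q` is monic without real zeros, so it keeps its sign from `1` to `+∞`.
  have hqpos : 0 < q.eval 1 := by
    by_contra! hneg
    have hqne : ∀ x, q.eval x ≠ 0 := fun x hx => by
      have : x ∈ q.roots := (mem_roots hqm.ne_zero).2 hx
      simp [hq0] at this
    by_cases hd : q.natDegree = 0
    · rw [hqm.natDegree_eq_zero.1 hd] at hneg
      norm_num at hneg
    · have ht : Filter.Tendsto (fun x => q.eval x) Filter.atTop Filter.atTop :=
        q.tendsto_atTop_of_leadingCoeff_nonneg
          (natDegree_pos_iff_degree_pos.1 (Nat.pos_of_ne_zero hd)) (by rw [hqm]; norm_num)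
      obtain ⟨x, hx1, hx⟩ := ((ht.eventually_ge_atTop 0).and
        (Filter.eventually_ge_atTop 1)).exists
      obtain ⟨y, -, hy⟩ := intermediate_value_Icc hx (q.continuous.continuousOn)
        (show (0 : ℝ) ∈ Icc (q.eval 1) (q.eval x) from ⟨hneg, hx1⟩)
      exact hqne y hy
  have hprod : ∀ s : Multiset ℝ, (1 : ℝ) ∉ s →
      ∃ c > 0, (s.map fun a => 1 - a).prod = c * (-1) ^ (s.filter (fun r => 1 < r)).card := by
    intro s
    induction s using Multiset.induction with
    | empty => intro _; exact ⟨1, one_pos, by simp⟩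
    | cons a s ih =>
      intro hs
      rw [Multiset.mem_cons, not_or] at hs
      obtain ⟨c, hc, e⟩ := ih hs.2
      rcases lt_or_gt_of_ne hs.1 with h | h
      · refine ⟨c * (a - 1), mul_pos hc (by linarith), ?_⟩
        rw [Multiset.map_cons, Multiset.prod_cons, e, Multiset.filter_cons_of_pos _ h,
          Multiset.card_cons, pow_succ]
        ring
      · refine ⟨c * (1 - a), mul_pos hc (by linarith), ?_⟩
        rw [Multiset.map_cons, Multiset.prod_cons, e,
          Multiset.filter_cons_of_neg _ (by linarith)]
        ring
  obtain ⟨c, hc, e⟩ := hprod _ h1'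
  rw [hodd.neg_one_pow] at e
  rw [← hq, eval_mul, eval_multiset_prod, Multiset.map_map]
  simp only [Function.comp_def, eval_sub, eval_X, eval_C]
  rw [e]
  nlinarith

-- After all real linear factors are split off with multiplicity, the cofactor has no real zero, so
-- it adds nothing to the complex count.
open Polynomial Classical in
theorem card_roots_filter_ofReal {p : ℝ[X]} (hp : p ≠ 0) :
    Multiset.card (((p.map (algebraMap ℝ ℂ)).roots).filter
      (fun μ : ℂ => ∃ r : ℝ, 1 < r ∧ μ = (r : ℂ)))
      = Multiset.card (p.roots.filter (fun r => 1 < r)) := by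
  obtain ⟨q, hq, -, hq0⟩ := exists_prod_multiset_X_sub_C_mul p
  have hm0 : p.map (algebraMap ℝ ℂ) ≠ 0 := by simpa using hp
  have hqne : q ≠ 0 := by rintro rfl; exact hp (by rw [← hq, mul_zero])
  have e : (p.map (algebraMap ℝ ℂ)).roots
      = p.roots.map (algebraMap ℝ ℂ) + (q.map (algebraMap ℝ ℂ)).roots := by
    have h2 : p.map (algebraMap ℝ ℂ) = ((p.roots.map (algebraMap ℝ ℂ)).map fun a => X - C a).prod
        * q.map (algebraMap ℝ ℂ) := by
      conv_lhs => rw [← hq, Polynomial.map_mul, Polynomial.map_multiset_prod]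
      simp [Multiset.map_map]
    rw [h2, roots_mul (by rw [← h2]; exact hm0), roots_multiset_prod_X_sub_C]
  have hq' : ((q.map (algebraMap ℝ ℂ)).roots).filter
      (fun μ : ℂ => ∃ r : ℝ, 1 < r ∧ μ = (r : ℂ)) = 0 := by
    rw [Multiset.filter_eq_nil]
    rintro _ hμ ⟨r, -, rfl⟩
    have h3 := isRoot_of_mem_roots hμ
    have h4 : q.IsRoot r := by
      have : (q.map (algebraMap ℝ ℂ)).IsRoot (algebraMap ℝ ℂ r) := h3
      exact (isRoot_map_iff (algebraMap ℝ ℂ).injective).1 this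
    have : r ∈ q.roots := (mem_roots hqne).2 h4
    simp [hq0] at this
  rw [e, Multiset.filter_add, hq', add_zero, Multiset.filter_map, Multiset.card_map]
  congr 1
  refine Multiset.filter_congr fun r _ => ?_
  simp

theorem det_one_sub_monodromy_neg {N : ℕ} {A : ℝ → RN N →L[ℝ] RN N} {T : ℝ}
    (hnd : (1 : ℂ) ∉ floquetMultipliers A T) (hodd : Odd (numRealMultipliersGtOne A T)) :
    (1 - monodromy A T).det < 0 := by
  have hm := LinearMap.charpoly_monic (monodromy A T : RN N →ₗ[ℝ] RN N)
  rw [numRealMultipliersGtOne, floquetMultipliers, card_roots_filter_ofReal hm.ne_zero] at hodd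
  have := eval_one_neg_of_odd_roots hm hnd hodd
  rw [LinearMap.eval_charpoly] at this
  simpa [ContinuousLinearMap.det] using this

/-! ### Degenerate operators and uniform invertibility on circles. -/

section Resolvent

variable {𝕜 E : Type*} [RCLike 𝕜] [NormedAddCommGroup E] [InnerProductSpace 𝕜 E]
  [FiniteDimensional 𝕜 E]

/-- Supplies the direction `l` of the initial history: pairing with it annihilates the left side of
the resolvent identity. -/
theorem exists_orthogonal_range_of_det_eq_zero {S : E →L[𝕜] E} (hS : S.det = 0) :
    ∃ l : E, ‖l‖ = 1 ∧ ∀ x, inner 𝕜 l (S x) = 0 := by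
  have h1 : LinearMap.range (S : E →ₗ[𝕜] E) ≠ ⊤ := by
    intro h
    have : LinearMap.ker (S : E →ₗ[𝕜] E) = ⊥ := LinearMap.ker_eq_bot_iff_range_eq_top.2 h
    exact LinearMap.det_eq_zero_iff_ker_ne_bot.1 hS this
  have h2 : (LinearMap.range (S : E →ₗ[𝕜] E))ᗮ ≠ ⊥ := fun h =>
    h1 (Submodule.orthogonal_eq_bot_iff.1 h)
  obtain ⟨l, hl, hl0⟩ := Submodule.exists_mem_ne_zero_of_ne_bot h2
  refine ⟨((‖l‖⁻¹ : ℝ) : 𝕜) • l, ?_, fun x => ?_⟩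
  · rw [norm_smul]
    simp [hl0]
  · have := (Submodule.mem_orthogonal' _ _).1 hl (S x) ⟨x, rfl⟩
    rw [inner_smul_left, this, mul_zero]

theorem differentiable_det {S : 𝕜 → E →L[𝕜] E} (hS : Differentiable 𝕜 S) :
    Differentiable 𝕜 fun w => (S w).det := by
  let b := Module.finBasis 𝕜 E
  have hent : ∀ i j, Differentiable 𝕜 fun w => LinearMap.toMatrix b b (S w : E →ₗ[𝕜] E) i j := by
    intro i j
    have : Differentiable 𝕜 fun w => (LinearMap.toContinuousLinearMap (b.coord i)) (S w (b j)) :=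
      (ContinuousLinearMap.differentiable _).comp (hS.clm_apply (differentiable_const _))
    simpa [LinearMap.toMatrix_apply] using this
  have e : (fun w => (S w).det) = fun w => (LinearMap.toMatrix b b (S w : E →ₗ[𝕜] E)).det := by
    funext w
    rw [LinearMap.det_toMatrix]
  rw [e]
  simp only [Matrix.det_apply]
  refine Differentiable.fun_sum fun σ _ => Differentiable.const_smul ?_ _
  exact Differentiable.fun_finsetProd fun i _ => hent _ _

end Resolvent

/-- By the identity theorem the zeros are isolated, and a discrete subset of the plane is countable.
-/
theorem countable_zeros_of_differentiable {e : ℂ → ℂ} (he : Differentiable ℂ e) {z : ℂ}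
    (hz : e z ≠ 0) : {w | e w = 0}.Countable := by
  have ha : AnalyticOnNhd ℂ e univ := he.differentiableOn.analyticOnNhd isOpen_univ
  rcases ha.eqOn_zero_or_eventually_ne_zero_of_preconnected isPreconnected_univ with h | h
  · exact absurd (h (mem_univ z)) hz
  · have hd : IsDiscrete ({w | e w = 0} ∩ univ) := isDiscrete_of_codiscreteWithin (by
      filter_upwards [h] with w hw
      simpa using hw)
    rw [inter_univ] at hd
    exact (HereditarilyLindelofSpace.isLindelof _).countable_of_isDiscrete hd

/-- An entire family of operators that is the identity at `0` is uniformly invertible on some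
circle in each annulus around `0`. -/
theorem exists_circle_uniformly_invertible {E : Type*} [NormedAddCommGroup E]
    [InnerProductSpace ℂ E] [FiniteDimensional ℂ E] {S : ℂ → E →L[ℂ] E} (hS : Differentiable ℂ S)
    (h0 : S 0 = 1) {a b : ℝ} (hab : a < b) :
    ∃ R ∈ Ioo a b, ∃ C, 0 ≤ C ∧ ∀ w : ℂ, ‖w‖ = R → ∀ x, ‖x‖ ≤ C * ‖S w x‖ := by
  have hc := countable_zeros_of_differentiable (differentiable_det hS) (z := 0) (by
    rw [h0]; simp [ContinuousLinearMap.det])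
  -- The zeros have only countably many moduli, so an uncountable interval contains a radius that
  -- avoids them.
  obtain ⟨R, hR, hRn⟩ : ∃ R ∈ Ioo a b, R ∉ norm '' {w | (S w).det = 0} := by
    by_contra! h
    have h1 : (Ioo a b).Countable := (hc.image norm).mono h
    have h2 := Cardinal.mk_Ioo_real hab
    have h3 := h1.le_aleph0
    rw [h2] at h3
    exact Cardinal.aleph0_lt_continuum.not_ge h3
  have : CompleteSpace E := FiniteDimensional.complete ℂ E
  have hu : ∀ w ∈ Metric.sphere (0 : ℂ) R, IsUnit (S w) := by
    intro w hw
    rw [ContinuousLinearMap.isUnit_iff_isUnit_toLinearMap, LinearMap.isUnit_iff_isUnit_det,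
      isUnit_iff_ne_zero]
    exact fun h => hRn ⟨w, h, by simpa using hw⟩
  have hcont : ContinuousOn (fun w => Ring.inverse (S w)) (Metric.sphere (0 : ℂ) R) := by
    intro w hw
    obtain ⟨u, hu⟩ := hu w hw
    have h1 := NormedRing.inverse_continuousAt u
    rw [hu] at h1
    exact (ContinuousAt.comp (f := S) h1 hS.continuous.continuousAt).continuousWithinAt
  obtain ⟨C, hC⟩ := (isCompact_sphere (0 : ℂ) R).exists_bound_of_continuousOn hcont
  refine ⟨R, hR, max C 0, le_max_right _ _, fun w hw x => ?_⟩
  have hw' : w ∈ Metric.sphere (0 : ℂ) R := by simpa using hw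
  have e : Ring.inverse (S w) (S w x) = x := by
    rw [← mul_apply_eq_comp, Ring.inverse_mul_cancel _ (hu w hw')]; rfl
  calc ‖x‖ = ‖Ring.inverse (S w) (S w x)‖ := by rw [e]
    _ ≤ ‖Ring.inverse (S w)‖ * ‖S w x‖ := ContinuousLinearMap.le_opNorm _ _
    _ ≤ _ := by
      gcongr
      exact (hC w hw').trans (le_max_left _ _)

/-! ### Energy estimate in `L²` and discrete Parseval identity. -/

/-- Energy estimate for a linear differential inequality with zero initial value. -/
theorem norm_sq_le_of_linear_deriv {𝕜 E : Type*} [RCLike 𝕜] [NormedAddCommGroup E]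
    [InnerProductSpace 𝕜 E] [NormedSpace ℝ E] {Z Z' : ℝ → E} {H : ℝ → ℝ} {T c : ℝ} (hc : 0 ≤ c)
    (hZc : ContinuousOn Z (Icc 0 T)) (hZ : ∀ t ∈ Ioo 0 T, HasDerivAt Z (Z' t) t) (h0 : Z 0 = 0)
    (hH : Continuous H) (hbd : ∀ t ∈ Ioo 0 T, ‖Z' t‖ ≤ c * ‖Z t‖ + H t) :
    ∀ t ∈ Icc 0 T, ‖Z t‖ ^ 2 ≤ Real.exp ((2 * c + 1) * T) * ∫ s in (0 : ℝ)..T, H s ^ 2 := by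
  -- From `2 ‖Z‖ H ≤ ‖Z‖² + H²`, the derivative of `‖Z‖²` is at most `γ ‖Z‖² + H²`; hence `F` below
  -- is antitone.
  set γ : ℝ := 2 * c + 1 with hγ
  have hH2 : Continuous fun s => H s ^ 2 := hH.pow 2
  let F : ℝ → ℝ := fun t => Real.exp (-(γ * t)) * ‖Z t‖ ^ 2 - ∫ s in (0 : ℝ)..t, H s ^ 2
  have hI : ∀ t, HasDerivAt (fun t => ∫ s in (0 : ℝ)..t, H s ^ 2) (H t ^ 2) t := fun t =>
    intervalIntegral.integral_hasDerivAt_right (hH2.intervalIntegrable _ _)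
      (hH2.stronglyMeasurableAtFilter _ _) hH2.continuousAt
  have hIc : Continuous fun t => ∫ s in (0 : ℝ)..t, H s ^ 2 :=
    continuous_iff_continuousAt.2 fun t => (hI t).continuousAt
  have hsq : ∀ t ∈ Ioo 0 T, HasDerivAt (fun t => ‖Z t‖ ^ 2)
      (2 * RCLike.re (inner 𝕜 (Z t) (Z' t))) t := by
    intro t ht
    have h1 := (hZ t ht).inner 𝕜 (hZ t ht)
    have h2 := (RCLike.reCLM (K := 𝕜)).hasFDerivAt.comp_hasDerivAt t h1
    refine (h2.congr_deriv ?_).congr_of_eventuallyEq ?_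
    · simp only [RCLike.reCLM_apply, map_add]
      rw [← inner_conj_symm (Z' t) (Z t), RCLike.conj_re]; ring
    · exact Filter.Eventually.of_forall fun s => (inner_self_eq_norm_sq (𝕜 := 𝕜) (Z s)).symm
  have hF : ∀ t ∈ Ioo 0 T, HasDerivAt F (Real.exp (-(γ * t)) * (-γ) * ‖Z t‖ ^ 2
      + Real.exp (-(γ * t)) * (2 * RCLike.re (inner 𝕜 (Z t) (Z' t))) - H t ^ 2) t := by
    intro t ht
    have h1 : HasDerivAt (fun t => Real.exp (-(γ * t))) (Real.exp (-(γ * t)) * (-γ)) t := by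
      have := (((hasDerivAt_id t).const_mul γ).neg).exp
      simpa using this
    exact (h1.mul (hsq t ht)).sub (hI t)
  have hanti : AntitoneOn F (Icc 0 T) := by
    refine antitoneOn_of_deriv_nonpos (convex_Icc 0 T) ?_ ?_ ?_
    · exact ((Continuous.continuousOn (by fun_prop)).mul (hZc.norm.pow 2)).sub hIc.continuousOn
    · rw [interior_Icc]
      exact fun t ht => (hF t ht).differentiableAt.differentiableWithinAt
    · rw [interior_Icc]
      intro t ht
      rw [(hF t ht).deriv]
      have e1 : RCLike.re (inner 𝕜 (Z t) (Z' t)) ≤ ‖Z t‖ * (c * ‖Z t‖ + H t) :=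
        (re_inner_le_norm _ _).trans (mul_le_mul_of_nonneg_left (hbd t ht) (norm_nonneg _))
      have e2 : -γ * ‖Z t‖ ^ 2 + 2 * RCLike.re (inner 𝕜 (Z t) (Z' t)) ≤ H t ^ 2 := by
        rw [hγ]; nlinarith [sq_nonneg (‖Z t‖ - H t)]
      have e3 : Real.exp (-(γ * t)) ≤ 1 := Real.exp_le_one_iff.2 (by
        have := ht.1.le
        have : 0 ≤ γ := by rw [hγ]; positivity
        have := mul_nonneg this ht.1.le
        linarith)
      have e4 := Real.exp_nonneg (-(γ * t))
      have := mul_le_mul_of_nonneg_left e2 e4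
      nlinarith [sq_nonneg (H t)]
  intro t ht
  have hT : 0 ≤ T := ht.1.trans ht.2
  have h1 := hanti ⟨le_rfl, hT⟩ ht ht.1
  simp only [F, h0, norm_zero, mul_zero, neg_zero, Real.exp_zero, intervalIntegral.integral_same] at h1
  have h2 : ∫ s in (0 : ℝ)..t, H s ^ 2 ≤ ∫ s in (0 : ℝ)..T, H s ^ 2 :=
    intervalIntegral.integral_mono_interval le_rfl ht.1 ht.2
      (Filter.Eventually.of_forall fun s => sq_nonneg _) (hH2.intervalIntegrable _ _)
  have h3 : Real.exp (γ * t) * (Real.exp (-(γ * t)) * ‖Z t‖ ^ 2) = ‖Z t‖ ^ 2 := by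
    rw [← mul_assoc, ← Real.exp_add]; simp
  have hγ0 : 0 ≤ γ := by rw [hγ]; positivity
  rw [← h3]
  have h4 : 0 ≤ Real.exp (-(γ * t)) * ‖Z t‖ ^ 2 := by positivity
  refine mul_le_mul (Real.exp_le_exp.2 (by gcongr; exact ht.2)) (by linarith) h4
    (Real.exp_nonneg _)

/-- Parseval's identity for trigonometric polynomials, averaged over the roots of unity. -/
theorem exists_parseval_roots_of_unity {E : Type*} [NormedAddCommGroup E] [InnerProductSpace ℂ E]
    {M : ℕ} (hM : M ≠ 0) : ∃ ζ : ℂ, ‖ζ‖ = 1 ∧ ∀ v : ℕ → E,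
      ∑ k ∈ Finset.range M, ‖∑ n ∈ Finset.range M, (ζ ^ k) ^ n • v n‖ ^ 2
        = M * ∑ n ∈ Finset.range M, ‖v n‖ ^ 2 := by
  have hζ := Complex.isPrimitiveRoot_exp M hM
  set ζ := Complex.exp (2 * Real.pi * Complex.I / M) with hζdef
  have hn : ‖ζ‖ = 1 := hζ.norm'_eq_one hM
  have hζ0 : ζ ≠ 0 := norm_ne_zero_iff.1 (by rw [hn]; exact one_ne_zero)
  have hconj : (starRingEnd ℂ) ζ = ζ⁻¹ := by
    rw [Complex.inv_def, Complex.normSq_eq_norm_sq, hn]; simp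
  refine ⟨ζ, hn, fun v => ?_⟩
  -- All exponents are below `M`, so distinct ones give distinct powers of `ζ`; the finite average
  -- is exact and replaces an integral over the circle.
  have horth : ∀ n ∈ Finset.range M, ∀ m ∈ Finset.range M,
      ∑ k ∈ Finset.range M, (starRingEnd ℂ) ((ζ ^ k) ^ n) * (ζ ^ k) ^ m
        = if n = m then (M : ℂ) else 0 := by
    intro n hn' m hm'
    have e : ∀ k, (starRingEnd ℂ) ((ζ ^ k) ^ n) * (ζ ^ k) ^ m = (ζ⁻¹ ^ n * ζ ^ m) ^ k := by
      intro k
      rw [map_pow, map_pow, hconj, mul_pow, ← pow_mul, ← pow_mul, ← pow_mul, ← pow_mul,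
        mul_comm k n, mul_comm k m]
    simp only [e]
    split_ifs with h
    · subst h
      rw [inv_pow, inv_mul_cancel₀ (pow_ne_zero _ hζ0)]
      simp
    · have hq : (ζ⁻¹ ^ n * ζ ^ m) ≠ 1 := by
        intro h1
        rw [inv_pow, inv_mul_eq_one₀ (pow_ne_zero _ hζ0)] at h1
        exact h (hζ.pow_inj (Finset.mem_range.1 hn') (Finset.mem_range.1 hm') h1)
      rw [geom_sum_eq hq]
      have : (ζ⁻¹ ^ n * ζ ^ m) ^ M = 1 := by
        rw [mul_pow, ← pow_mul, ← pow_mul, mul_comm n, mul_comm m, pow_mul, pow_mul, inv_pow,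
          hζ.pow_eq_one]
        simp
      rw [this]; simp
  have key : (∑ k ∈ Finset.range M, ((‖∑ n ∈ Finset.range M, (ζ ^ k) ^ n • v n‖ : ℂ)) ^ 2)
      = M * ∑ n ∈ Finset.range M, ((‖v n‖ : ℂ)) ^ 2 := by
    have e1 : ∀ k, ((‖∑ n ∈ Finset.range M, (ζ ^ k) ^ n • v n‖ : ℂ)) ^ 2
        = ∑ n ∈ Finset.range M, ∑ m ∈ Finset.range M,
          ((starRingEnd ℂ) ((ζ ^ k) ^ n) * (ζ ^ k) ^ m) * inner ℂ (v n) (v m) := by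
      intro k
      have := inner_self_eq_norm_sq_to_K (𝕜 := ℂ) (∑ n ∈ Finset.range M, (ζ ^ k) ^ n • v n)
      rw [sum_inner] at this
      simp only [inner_sum, inner_smul_left, inner_smul_right] at this
      rw [show ((‖∑ n ∈ Finset.range M, (ζ ^ k) ^ n • v n‖ : ℂ)) ^ 2 = _ from this.symm]
      refine Finset.sum_congr rfl fun n _ => Finset.sum_congr rfl fun m _ => by ring
    simp only [e1]
    rw [Finset.sum_comm, Finset.mul_sum]
    refine Finset.sum_congr rfl fun n hn' => ?_
    rw [Finset.sum_comm]
    have e2 : ∀ m ∈ Finset.range M, ∑ k ∈ Finset.range M,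
        ((starRingEnd ℂ) ((ζ ^ k) ^ n) * (ζ ^ k) ^ m) * inner ℂ (v n) (v m)
        = if n = m then M * (‖v n‖ : ℂ) ^ 2 else 0 := by
      intro m hm'
      rw [← Finset.sum_mul, horth n hn' m hm']
      split_ifs with h
      · subst h
        rw [inner_self_eq_norm_sq_to_K]; rfl
      · simp
    rw [Finset.sum_congr rfl e2, Finset.sum_ite_eq, if_pos hn']
  exact_mod_cast key

/-! ### Generating functions over the periods. -/

section GeneratingFunction

variable {𝕜 E : Type*} [RCLike 𝕜] [NormedAddCommGroup E] [InnerProductSpace 𝕜 E]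

/-- The truncated generating function `∑ n < M, w ^ n y(t + n T)`. -/
def genFun (T : ℝ) (M : ℕ) (w : 𝕜) (y : ℝ → E) (t : ℝ) : E :=
  ∑ n ∈ Finset.range M, w ^ n • y (t + n * T)

/-- Shifting by a period telescopes the sum: a delay becomes multiplication by `w`, up to two
boundary terms. -/
theorem genFun_add_period (T : ℝ) (M : ℕ) (w : 𝕜) (y : ℝ → E) (t : ℝ) :
    w • genFun T M w y (t + T) = genFun T M w y t - y t + w ^ M • y (t + M * T) := by
  have h1 := Finset.sum_range_succ (fun n : ℕ => w ^ n • y (t + n * T)) M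
  have h2 := Finset.sum_range_succ' (fun n : ℕ => w ^ n • y (t + n * T)) M
  have h3 : w • genFun T M w y (t + T)
      = ∑ n ∈ Finset.range M, w ^ (n + 1) • y (t + (n + 1 : ℕ) * T) := by
    rw [genFun, Finset.smul_sum]
    refine Finset.sum_congr rfl fun n _ => ?_
    rw [smul_smul, ← pow_succ']
    congr 2
    push_cast; ring
  rw [h1] at h2
  simp only [pow_zero, one_smul, Nat.cast_zero, zero_mul, add_zero] at h2
  rw [h3, genFun, eq_sub_of_add_eq h2.symm]
  abel

theorem continuous_genFun (T : ℝ) (M : ℕ) (w : 𝕜) {y : ℝ → E} (hy : Continuous y) :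
    Continuous (genFun T M w y) := by
  unfold genFun
  fun_prop

/-- The forcing term of the equation satisfied by the generating function of a solution. -/
def genForcing (K : E →L[𝕜] E) (T : ℝ) (M : ℕ) (w : 𝕜) (y g : ℝ → E) (t : ℝ) : E :=
  genFun T M w g t - K (y (t - T)) + w ^ M • K (y (t - T + M * T))

theorem continuous_genForcing (K : E →L[𝕜] E) (T : ℝ) (M : ℕ) (w : 𝕜) {y g : ℝ → E}
    (hy : Continuous y) (hg : Continuous g) : Continuous (genForcing K T M w y g) := by
  have := continuous_genFun T M w hg
  unfold genForcing
  fun_prop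

/-- Periodicity lets `A` leave the sum, and the shift identity removes the delay: `K (X(t) - X(t -
T))` is `(1 - w) K X(t)` plus the boundary terms collected in `genForcing`. -/
theorem hasDerivAt_genFun [NormedSpace ℝ E] [SMulCommClass ℝ 𝕜 E] {A : ℝ → E →L[𝕜] E} {K : E →L[𝕜] E} {T : ℝ} (hT : 0 < T)
    (hper : ∀ t, A (t + T) = A t) {M : ℕ} (w : 𝕜) {y g : ℝ → E}
    (hy : ∀ t ∈ Ioo 0 (M * T), HasDerivAt y (A t (y t) + K (y t - y (t - T)) + g t) t)
    {t : ℝ} (ht : t ∈ Ioo 0 T) :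
    HasDerivAt (genFun T M w y)
      ((A t + (1 - w) • K) (genFun T M w y t) + genForcing K T M w y g t) t := by
  have hper' : ∀ n : ℕ, ∀ t, A (t + n * T) = A t := by
    intro n
    induction n with
    | zero => intro t; simp
    | succ n ih =>
      intro t
      rw [← ih t, ← hper (t + n * T)]
      congr 1; push_cast; ring
  have h1 : ∀ n ∈ Finset.range M, HasDerivAt (fun t => w ^ n • y (t + n * T))
      (w ^ n • (A t (y (t + n * T)) + K (y (t + n * T) - y (t - T + n * T)) + g (t + n * T))) t := by
    intro n hn
    have hmem : t + n * T ∈ Ioo 0 (M * T) := by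
      constructor
      · have := ht.1; positivity
      · have : (n : ℝ) + 1 ≤ M := by exact_mod_cast Finset.mem_range.1 hn
        nlinarith [ht.2]
    have h2 := hy _ hmem
    rw [hper' n t, show t + n * T - T = t - T + n * T by ring] at h2
    exact (h2.comp_add_const t (n * T)).const_smul (w ^ n)
  have h3 := HasDerivAt.fun_sum h1
  refine h3.congr_deriv ?_
  have h4 := genFun_add_period T M w y (t - T)
  rw [sub_add_cancel] at h4
  have e : ∑ n ∈ Finset.range M, w ^ n •
      (A t (y (t + n * T)) + K (y (t + n * T) - y (t - T + n * T)) + g (t + n * T))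
      = A t (genFun T M w y t) + K (genFun T M w y t) - K (genFun T M w y (t - T))
        + genFun T M w g t := by
    simp only [genFun, map_sum, map_smul, ← Finset.sum_add_distrib, ← Finset.sum_sub_distrib,
      map_sub, smul_add, smul_sub]
    refine Finset.sum_congr rfl fun n _ => by abel
  have h5 : genFun T M w y (t - T)
      = w • genFun T M w y t + y (t - T) - w ^ M • y (t - T + M * T) := by
    rw [h4]; abel
  rw [e, h5, genForcing]
  simp only [add_apply, sub_apply, smul_apply, map_add, map_sub, map_smul, sub_smul, one_smul]
  abel

/-- Comparison of the generating function with the fundamental solution. -/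
theorem genFun_sub_fundamental [NormedSpace ℝ E] [SMulCommClass ℝ 𝕜 E] [IsScalarTower ℝ 𝕜 E] {A : ℝ → E →L[𝕜] E}
    {K : E →L[𝕜] E} {T c : ℝ} (hT : 0 < T)
    (hper : ∀ t, A (t + T) = A t) {M : ℕ} (w : 𝕜) {y g : ℝ → E} (hyc : Continuous y)
    (hg : Continuous g)
    (hy : ∀ t ∈ Ioo 0 (M * T), HasDerivAt y (A t (y t) + K (y t - y (t - T)) + g t) t)
    {Y : 𝕜 → ℝ → E →L[𝕜] E} (hY : IsFundamentalFamily A K T Y)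
    (hc : 0 ≤ c) (hcb : ∀ t ∈ Icc 0 T, ‖A t + (1 - w) • K‖ ≤ c) :
    (∀ t ∈ Icc 0 T, ‖genFun T M w y t - Y (1 - w) t (genFun T M w y 0)‖ ^ 2
      ≤ Real.exp ((2 * c + 1) * T) * ∫ s in (0 : ℝ)..T, ‖genForcing K T M w y g s‖ ^ 2) ∧
    (1 - w • Y (1 - w) T) (genFun T M w y 0) = y 0 - w ^ M • y (M * T)
      + w • (genFun T M w y T - Y (1 - w) T (genFun T M w y 0)) := by
  constructor
  · refine norm_sq_le_of_linear_deriv (𝕜 := 𝕜)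
      (Z' := fun t => ((A t + (1 - w) • K) (genFun T M w y t) + genForcing K T M w y g t)
        - ((A t + (1 - w) • K) * Y (1 - w) t) (genFun T M w y 0)) hc ?_ ?_ ?_
      (continuous_genForcing K T M w hyc hg).norm ?_
    · have := continuous_genFun T M w hyc
      have h2 := hY.continuous (1 - w)
      exact (this.sub (h2.clm_apply continuous_const)).continuousOn
    · intro t ht
      refine (hasDerivAt_genFun hT hper w hy ht).sub ?_
      have h1 := hY.deriv (1 - w) t ⟨ht.1.le, ht.2.le⟩
      have h2 := (((ContinuousLinearMap.apply 𝕜 E (genFun T M w y 0)).restrictScalars ℝ).hasFDerivAt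
        (x := Y (1 - w) t)).comp_hasDerivAt t h1
      exact h2
    · simp [hY.init]
    · intro t ht
      have e : (A t + (1 - w) • K) (genFun T M w y t) + genForcing K T M w y g t
          - ((A t + (1 - w) • K) * Y (1 - w) t) (genFun T M w y 0)
          = (A t + (1 - w) • K) (genFun T M w y t - Y (1 - w) t (genFun T M w y 0))
            + genForcing K T M w y g t := by
        rw [map_sub, mul_apply_eq_comp]; abel
      rw [e]
      refine (norm_add_le _ _).trans (add_le_add_left ?_ _)
      exact (ContinuousLinearMap.le_opNorm _ _).trans
        (mul_le_mul_of_nonneg_right (hcb t ⟨ht.1.le, ht.2.le⟩) (norm_nonneg _))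
  -- The second claim is the shift identity at `0`, with `X(T)` split into `Y (1 - w) T (X 0)` and
  -- the error.
  · have h4 := genFun_add_period T M w y 0
    rw [zero_add, zero_add] at h4
    rw [smul_sub, h4]
    simp only [sub_apply, smul_apply,
      one_apply_eq_self]
    abel

end GeneratingFunction

theorem integral_norm_sq_genForcing_le {𝕜 E : Type*} [RCLike 𝕜] [NormedAddCommGroup E]
    [InnerProductSpace 𝕜 E] (K : E →L[𝕜] E) {T σ : ℝ} (hT : 0 < T) {M : ℕ} (w : 𝕜)
    {y g : ℝ → E} (hyc : Continuous y) (hg : Continuous g)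
    (h1 : ∀ t ∈ Icc (-T) 0, ‖y t‖ ≤ σ)
    (h2 : ∀ t ∈ Icc 0 T, ‖w‖ ^ M * ‖y (t - T + M * T)‖ ≤ σ) :
    ∫ s in (0 : ℝ)..T, ‖genForcing K T M w y g s‖ ^ 2
      ≤ 2 * (∫ s in (0 : ℝ)..T, ‖genFun T M w g s‖ ^ 2) + 8 * ‖K‖ ^ 2 * σ ^ 2 * T := by
  have c1 := continuous_genForcing K T M w hyc hg
  have c2 := continuous_genFun T M w hg
  have hle : ∀ s ∈ Icc 0 T, ‖genForcing K T M w y g s‖ ^ 2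
      ≤ 2 * ‖genFun T M w g s‖ ^ 2 + 8 * ‖K‖ ^ 2 * σ ^ 2 := by
    intro s hs
    have e1 : ‖K (y (s - T))‖ ≤ ‖K‖ * σ := (K.le_opNorm _).trans (by
      gcongr
      exact h1 _ ⟨by linarith [hs.1], by linarith [hs.2]⟩)
    have e2 : ‖w ^ M • K (y (s - T + M * T))‖ ≤ ‖K‖ * σ := by
      rw [norm_smul, norm_pow]
      calc ‖w‖ ^ M * ‖K (y (s - T + M * T))‖ ≤ ‖w‖ ^ M * (‖K‖ * ‖y (s - T + M * T)‖) := by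
            gcongr; exact K.le_opNorm _
        _ = ‖K‖ * (‖w‖ ^ M * ‖y (s - T + M * T)‖) := by ring
        _ ≤ _ := by gcongr; exact h2 s hs
    have e3 : ‖genForcing K T M w y g s‖ ≤ ‖genFun T M w g s‖ + 2 * (‖K‖ * σ) := by
      rw [genForcing]
      refine (norm_add_le _ _).trans ?_
      have := norm_sub_le (genFun T M w g s) (K (y (s - T)))
      linarith
    have e4 : ‖genForcing K T M w y g s‖ ^ 2 ≤ (‖genFun T M w g s‖ + 2 * (‖K‖ * σ)) ^ 2 := by
      gcongr
    nlinarith [sq_nonneg (‖genFun T M w g s‖ - 2 * (‖K‖ * σ))]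
  calc _ ≤ ∫ s in (0 : ℝ)..T, (2 * ‖genFun T M w g s‖ ^ 2 + 8 * ‖K‖ ^ 2 * σ ^ 2) :=
        intervalIntegral.integral_mono_on hT.le ((c1.norm.pow 2).intervalIntegrable _ _)
          (Continuous.intervalIntegrable (by fun_prop) _ _) hle
    _ = _ := by
      rw [intervalIntegral.integral_add (Continuous.intervalIntegrable (by fun_prop) _ _)
        (Continuous.intervalIntegrable (by fun_prop) _ _), intervalIntegral.integral_const_mul,
        intervalIntegral.integral_const]
      simp; ring

/-! ### Weighted bounds from a circle free of characteristic values. -/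

section Weighted

variable {E : Type*} [NormedAddCommGroup E] [InnerProductSpace ℂ E] [FiniteDimensional ℂ E]
  [NormedSpace ℝ E] [IsScalarTower ℝ ℂ E]

/-- On the chosen circle the resolvent identity can be solved for `X_w(0)`, and the energy estimate
propagates the bound over one period. The constant depends neither on `M` nor on the solution. -/
theorem exists_circle_genFun_bound {A : ℝ → E →L[ℂ] E} (hA : Continuous A) (K : E →L[ℂ] E)
    {T : ℝ} (hT : 0 < T) (hper : ∀ t, A (t + T) = A t) {a b : ℝ} (hab : a < b)
    (hb : b ≤ 1) :
    ∃ R ∈ Ioo a b, ∃ C, 0 ≤ C ∧ ∀ (M : ℕ) (y g : ℝ → E) (σ : ℝ), Continuous y → Continuous g →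
      (∀ t ∈ Ioo 0 (M * T), HasDerivAt y (A t (y t) + K (y t - y (t - T)) + g t) t) →
      (∀ t ∈ Icc (-T) 0, ‖y t‖ ≤ σ) → (∀ t ∈ Icc (M * T - T) (M * T), R ^ M * ‖y t‖ ≤ σ) →
      ∀ w : ℂ, ‖w‖ = R → ∀ t ∈ Icc 0 T, ‖genFun T M w y t‖ ^ 2
        ≤ C * ((∫ s in (0 : ℝ)..T, ‖genFun T M w g s‖ ^ 2) + σ ^ 2) := by
  have : CompleteSpace E := FiniteDimensional.complete ℂ E
  obtain ⟨Y, hY⟩ := exists_isFundamentalFamily (𝕜 := ℂ) hA hT.le K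
  have hdiff : Differentiable ℂ fun w : ℂ => (1 : E →L[ℂ] E) - w • Y (1 - w) T :=
    (differentiable_const _).sub (differentiable_id.smul
      ((hY.differentiable_param hA hT.le).comp ((differentiable_const _).sub differentiable_id)))
  obtain ⟨R, hR, CR, hCR0, hCR⟩ := exists_circle_uniformly_invertible hdiff (by simp) hab
  -- The radius `2` covers every parameter `1 - w` with `‖w‖ ≤ 1`.
  obtain ⟨m, hm0, hm⟩ := hY.norm_le hA hT.le 2 (by norm_num)
  obtain ⟨α, hα⟩ := (isCompact_Icc (a := 0) (b := T)).exists_bound_of_continuousOn hA.continuousOn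
  have hα0 : 0 ≤ α := (norm_nonneg _).trans (hα 0 ⟨le_rfl, hT.le⟩)
  set c : ℝ := α + 2 * ‖K‖ with hc
  have hc0 : 0 ≤ c := by positivity
  set s : ℝ := Real.exp ((2 * c + 1) * T) with hs
  have hs0 : 0 ≤ s := Real.exp_nonneg _
  refine ⟨R, hR, (2 + 4 * m ^ 2 * CR ^ 2) * s * (2 + 8 * ‖K‖ ^ 2 * T) + 16 * m ^ 2 * CR ^ 2,
    by positivity, fun M y g σ hyc hg hy h1 h2 w hw t ht => ?_⟩
  have hw1 : ‖w‖ ≤ 1 := hw.le.trans (hR.2.le.trans hb)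
  have hκ : ‖1 - w‖ ≤ 2 := (norm_sub_le _ _).trans (by rw [norm_one]; linarith)
  have hσ : 0 ≤ σ := (norm_nonneg _).trans (h1 0 ⟨by linarith, le_rfl⟩)
  obtain ⟨hZ, hx0⟩ := genFun_sub_fundamental hT hper w hyc hg hy hY hc0 (fun t ht => by
    refine (norm_add_le _ _).trans (add_le_add (hα t ht) ?_)
    rw [norm_smul]; gcongr)
  have hI := integral_norm_sq_genForcing_le K hT (M := M) w hyc hg h1 (fun t ht => by
    rw [hw]; exact h2 _ ⟨by linarith [ht.1], by linarith [ht.2]⟩)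
  set X := genFun T M w y with hX
  set I := ∫ s in (0 : ℝ)..T, ‖genFun T M w g s‖ ^ 2 with hIdef
  have hI0 : 0 ≤ I := intervalIntegral.integral_nonneg hT.le fun _ _ => sq_nonneg _
  have hV : ∀ t ∈ Icc 0 T, ‖X t - Y (1 - w) t (X 0)‖ ^ 2
      ≤ s * (2 * I + 8 * ‖K‖ ^ 2 * σ ^ 2 * T) := fun t ht =>
    (hZ t ht).trans (mul_le_mul_of_nonneg_left hI hs0)
  set V := s * (2 * I + 8 * ‖K‖ ^ 2 * σ ^ 2 * T) with hVdef
  have hx : ‖X 0‖ ≤ CR * (2 * σ + ‖X T - Y (1 - w) T (X 0)‖) := by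
    refine (hCR w hw (X 0)).trans ?_
    gcongr
    rw [hx0]
    have e1 := h1 0 ⟨by linarith, le_rfl⟩
    have e2 : ‖w ^ M • y (M * T)‖ ≤ σ := by
      rw [norm_smul, norm_pow, hw]; exact h2 _ ⟨by linarith, le_rfl⟩
    have e3 : ‖w • (X T - Y (1 - w) T (X 0))‖ ≤ ‖X T - Y (1 - w) T (X 0)‖ := by
      rw [norm_smul]
      exact mul_le_of_le_one_left (norm_nonneg _) hw1
    have e4 := norm_add_le (y 0 - w ^ M • y (M * T)) (w • (X T - Y (1 - w) T (X 0)))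
    have e5 := norm_sub_le (y 0) (w ^ M • y (M * T))
    linarith
  have hXt : ‖X t‖ ≤ ‖X t - Y (1 - w) t (X 0)‖ + m * ‖X 0‖ := by
    have e1 := norm_add_le (X t - Y (1 - w) t (X 0)) (Y (1 - w) t (X 0))
    rw [sub_add_cancel] at e1
    refine e1.trans (add_le_add_right ?_ _)
    exact (ContinuousLinearMap.le_opNorm _ _).trans
      (mul_le_mul_of_nonneg_right (hm _ hκ t ht) (norm_nonneg _))
  have f1 := hV t ht
  have f2 := hV T ⟨hT.le, le_rfl⟩
  set z1 := ‖X t - Y (1 - w) t (X 0)‖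
  set z2 := ‖X T - Y (1 - w) T (X 0)‖
  have hz2 : 0 ≤ z2 := norm_nonneg _
  have hx2 : ‖X 0‖ ^ 2 ≤ CR ^ 2 * (8 * σ ^ 2 + 2 * V) := by
    calc ‖X 0‖ ^ 2 ≤ (CR * (2 * σ + z2)) ^ 2 := by gcongr
      _ = CR ^ 2 * (2 * σ + z2) ^ 2 := by ring
      _ ≤ CR ^ 2 * (8 * σ ^ 2 + 2 * V) := by
        gcongr
        nlinarith [sq_nonneg (2 * σ - z2)]
  have hXt2 : ‖X t‖ ^ 2 ≤ 2 * V + 2 * m ^ 2 * (CR ^ 2 * (8 * σ ^ 2 + 2 * V)) := by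
    calc ‖X t‖ ^ 2 ≤ (z1 + m * ‖X 0‖) ^ 2 := by gcongr
      _ ≤ 2 * z1 ^ 2 + 2 * m ^ 2 * ‖X 0‖ ^ 2 := by nlinarith [sq_nonneg (z1 - m * ‖X 0‖)]
      _ ≤ _ := by gcongr
  have hVle : V ≤ s * (2 + 8 * ‖K‖ ^ 2 * T) * (I + σ ^ 2) := by
    rw [hVdef, mul_assoc s (2 + 8 * ‖K‖ ^ 2 * T)]
    refine mul_le_mul_of_nonneg_left ?_ hs0
    have : 0 ≤ 8 * ‖K‖ ^ 2 * T * I := by positivity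
    nlinarith [sq_nonneg σ]
  calc _ ≤ _ := hXt2
    _ = (2 + 4 * m ^ 2 * CR ^ 2) * V + 16 * m ^ 2 * CR ^ 2 * σ ^ 2 := by ring
    _ ≤ (2 + 4 * m ^ 2 * CR ^ 2) * (s * (2 + 8 * ‖K‖ ^ 2 * T) * (I + σ ^ 2))
        + 16 * m ^ 2 * CR ^ 2 * (I + σ ^ 2) := by
      gcongr
      linarith
    _ = _ := by ring

/-- The weighted square norm of a function over `M` periods. -/
noncomputable def weightedSq {E : Type*} [NormedAddCommGroup E] (T R : ℝ) (M : ℕ) (y : ℝ → E) :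
    ℝ :=
  ∫ t in (0 : ℝ)..T, ∑ n ∈ Finset.range M, R ^ (2 * n) * ‖y (t + n * T)‖ ^ 2

/-- Sum the circle bound over the `M` points `R ζ^k`. Parseval turns both sums into `M` times
weighted squares, and the `σ²` term also occurs `M` times, so `M` cancels. Integration over a period
contributes the factor `T`. -/
theorem exists_weightedSq_bound {A : ℝ → E →L[ℂ] E} (hA : Continuous A) (K : E →L[ℂ] E)
    {T : ℝ} (hT : 0 < T) (hper : ∀ t, A (t + T) = A t) {a b : ℝ} (ha : 0 ≤ a) (hab : a < b)
    (hb : b ≤ 1) :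
    ∃ R ∈ Ioo a b, ∃ C, 0 ≤ C ∧ ∀ (M : ℕ) (y g : ℝ → E) (σ : ℝ), M ≠ 0 → Continuous y →
      Continuous g →
      (∀ t ∈ Ioo 0 (M * T), HasDerivAt y (A t (y t) + K (y t - y (t - T)) + g t) t) →
      (∀ t ∈ Icc (-T) 0, ‖y t‖ ≤ σ) → (∀ t ∈ Icc (M * T - T) (M * T), R ^ M * ‖y t‖ ≤ σ) →
      weightedSq T R M y ≤ C * (weightedSq T R M g + σ ^ 2) := by
  obtain ⟨R, hR, C, hC0, hC⟩ := exists_circle_genFun_bound hA K hT hper hab hb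
  have hR0 : 0 ≤ R := ha.trans hR.1.le
  refine ⟨R, hR, T * C, by positivity, fun M y g σ hM hyc hg hy h1 h2 => ?_⟩
  obtain ⟨ζ, hζ, hpars⟩ := exists_parseval_roots_of_unity (E := E) hM
  have hM0 : (0 : ℝ) < M := by exact_mod_cast Nat.pos_of_ne_zero hM
  have hp : ∀ (u : ℝ → E) (t : ℝ), ∑ k ∈ Finset.range M, ‖genFun T M ((R : ℂ) * ζ ^ k) u t‖ ^ 2
      = M * ∑ n ∈ Finset.range M, R ^ (2 * n) * ‖u (t + n * T)‖ ^ 2 := by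
    intro u t
    have := hpars fun n => ((R : ℂ) ^ n) • u (t + n * T)
    simp only [norm_smul, norm_pow, Complex.norm_real, Real.norm_of_nonneg hR0, mul_pow,
      ← pow_mul, smul_smul] at this
    simp only [genFun]
    rw [show ∑ n ∈ Finset.range M, R ^ (2 * n) * ‖u (t + n * T)‖ ^ 2
      = ∑ n ∈ Finset.range M, R ^ (n * 2) * ‖u (t + n * T)‖ ^ 2 from
      Finset.sum_congr rfl fun n _ => by rw [mul_comm 2 n], ← this]
    refine Finset.sum_congr rfl fun k _ => ?_
    congr 2
    refine Finset.sum_congr rfl fun n _ => ?_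
    rw [mul_pow, ← pow_mul, mul_comm]
  have hw : ∀ k, ‖(R : ℂ) * ζ ^ k‖ = R := fun k => by
    rw [norm_mul, norm_pow, hζ, Complex.norm_real, Real.norm_of_nonneg hR0]; simp
  have hsum : ∑ k ∈ Finset.range M, ∫ s in (0 : ℝ)..T, ‖genFun T M ((R : ℂ) * ζ ^ k) g s‖ ^ 2
      = M * weightedSq T R M g := by
    rw [weightedSq, ← intervalIntegral.integral_const_mul, ← intervalIntegral.integral_finsetSum]
    · simp only [hp]
    · exact fun k _ => ((continuous_genFun T M _ hg).norm.pow 2).intervalIntegrable _ _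
  have hpt : ∀ t ∈ Icc 0 T, ∑ n ∈ Finset.range M, R ^ (2 * n) * ‖y (t + n * T)‖ ^ 2
      ≤ C * (weightedSq T R M g + σ ^ 2) := by
    intro t ht
    have := Finset.sum_le_sum fun k (_ : k ∈ Finset.range M) =>
      hC M y g σ hyc hg hy h1 h2 _ (hw k) t ht
    rw [hp, ← Finset.mul_sum, Finset.sum_add_distrib, hsum, Finset.sum_const, Finset.card_range,
      nsmul_eq_mul] at this
    refine le_of_mul_le_mul_left (this.trans (le_of_eq ?_)) hM0
    ring
  have hmono := intervalIntegral.integral_mono_on (μ := MeasureTheory.volume) hT.le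
    (Continuous.intervalIntegrable (by fun_prop) _ _)
    (intervalIntegrable_const (c := C * (weightedSq T R M g + σ ^ 2))) hpt
  rw [weightedSq]
  refine hmono.trans (le_of_eq ?_)
  rw [intervalIntegral.integral_const]
  simp; ring

end Weighted

/-! ### Transfer of the weighted bound to real systems. -/

section Complexification

variable {N : ℕ}

/-- The inclusion `ℝ^N → ℂ^N`. -/
noncomputable def cplxVec (N : ℕ) : RN N →L[ℝ] EuclideanSpace ℂ (Fin N) :=
  LinearMap.toContinuousLinearMap
    { toFun := fun x => WithLp.toLp 2 fun i => (x i : ℂ)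
      map_add' := fun x y => by ext i; simp
      map_smul' := fun r x => by ext i; simp }

theorem cplxVec_apply (x : RN N) (i : Fin N) : cplxVec N x i = (x i : ℂ) := rfl

theorem norm_cplxVec (x : RN N) : ‖cplxVec N x‖ = ‖x‖ := by
  rw [EuclideanSpace.norm_eq, EuclideanSpace.norm_eq]
  simp [cplxVec_apply]

/-- The complexification of an operator on `ℝ^N`. -/
noncomputable def cplxOp (B : RN N →L[ℝ] RN N) :
    EuclideanSpace ℂ (Fin N) →L[ℂ] EuclideanSpace ℂ (Fin N) :=
  Matrix.toEuclideanCLM (𝕜 := ℂ)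
    (((Matrix.toEuclideanCLM (n := Fin N) (𝕜 := ℝ)).symm B).map Complex.ofReal)

theorem cplxOp_cplxVec (B : RN N →L[ℝ] RN N) (x : RN N) :
    cplxOp B (cplxVec N x) = cplxVec N (B x) := by
  obtain ⟨m, rfl⟩ : ∃ m, Matrix.toEuclideanCLM (n := Fin N) (𝕜 := ℝ) m = B :=
    ⟨_, StarAlgEquiv.apply_symm_apply _ _⟩
  ext i
  rw [cplxVec_apply, cplxOp, StarAlgEquiv.symm_apply_apply]
  simp [Matrix.mulVec, dotProduct, cplxVec_apply]

theorem continuous_cplxOp : Continuous (cplxOp (N := N)) := by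
  have h1 : Continuous fun B : RN N →L[ℝ] RN N =>
      (Matrix.toEuclideanCLM (n := Fin N) (𝕜 := ℝ)).symm B :=
    LinearMap.continuous_of_finiteDimensional
      ((Matrix.toEuclideanCLM (n := Fin N) (𝕜 := ℝ)).symm.toAlgEquiv.toLinearMap)
  have h2 : Continuous fun m : Matrix (Fin N) (Fin N) ℂ => Matrix.toEuclideanCLM (𝕜 := ℂ) m :=
    LinearMap.continuous_of_finiteDimensional
      ((Matrix.toEuclideanCLM (n := Fin N) (𝕜 := ℂ)).toAlgEquiv.toLinearMap)
  exact h2.comp (h1.matrix_map Complex.continuous_ofReal)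

end Complexification

/-- The circle argument needs complex `w`; the statement itself does not mention `w`, and the
inclusion into `ℂ^N` preserves norms. -/
theorem exists_weightedSq_bound_real {N : ℕ} {A : ℝ → RN N →L[ℝ] RN N} (hA : Continuous A)
    (K : RN N →L[ℝ] RN N) {T : ℝ} (hT : 0 < T) (hper : ∀ t, A (t + T) = A t) {a b : ℝ}
    (ha : 0 ≤ a) (hab : a < b) (hb : b ≤ 1) :
    ∃ R ∈ Ioo a b, ∃ C, 0 ≤ C ∧ ∀ (M : ℕ) (y g : ℝ → RN N) (σ : ℝ), M ≠ 0 → Continuous y →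
      Continuous g →
      (∀ t ∈ Ioo 0 (M * T), HasDerivAt y (A t (y t) + K (y t - y (t - T)) + g t) t) →
      (∀ t ∈ Icc (-T) 0, ‖y t‖ ≤ σ) → (∀ t ∈ Icc (M * T - T) (M * T), R ^ M * ‖y t‖ ≤ σ) →
      weightedSq T R M y ≤ C * (weightedSq T R M g + σ ^ 2) := by
  obtain ⟨R, hR, C, hC0, hC⟩ := exists_weightedSq_bound (continuous_cplxOp.comp hA) (cplxOp K) hT
    (fun t => by simp [hper t]) ha hab hb
  refine ⟨R, hR, C, hC0, fun M y g σ hM hyc hg hy h1 h2 => ?_⟩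
  have := hC M (fun t => cplxVec N (y t)) (fun t => cplxVec N (g t)) σ hM
    ((cplxVec N).continuous.comp hyc) ((cplxVec N).continuous.comp hg)
    (fun t ht => by
      refine ((cplxVec N).hasFDerivAt.comp_hasDerivAt t (hy t ht)).congr_deriv ?_
      rw [map_add, map_add, ← cplxOp_cplxVec, ← cplxOp_cplxVec, map_sub]; rfl)
    (fun t ht => by rw [norm_cplxVec]; exact h1 t ht)
    (fun t ht => by rw [norm_cplxVec]; exact h2 t ht)
  simpa only [weightedSq, norm_cplxVec] using this

/-! ### The characteristic zero and estimates at it. -/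

theorem IsFundamentalFamily.eq_monodromy {N : ℕ} {A : ℝ → RN N →L[ℝ] RN N} (hA : Continuous A)
    {K : RN N →L[ℝ] RN N} {T : ℝ} (hT : 0 ≤ T) {Y : ℝ → ℝ → RN N →L[ℝ] RN N}
    (hY : IsFundamentalFamily A K T Y) : Y 0 T = monodromy A T := by
  have hZ := fundamentalSolution_spec hA
  obtain ⟨a, ha⟩ := (isCompact_Icc (a := 0) (b := T)).exists_bound_of_continuousOn hA.continuousOn
  have ha0 : 0 ≤ a := (norm_nonneg _).trans (ha 0 ⟨le_rfl, hT⟩)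
  have := norm_le_of_linear_deriv (y := fun t => Y 0 t - fundamentalSolution A t)
    (y' := fun t => (A t + (0 : ℝ) • K) * Y 0 t - A t ∘L fundamentalSolution A t) (b := T)
    (c := a + 1) (e := 0) (by positivity) le_rfl
    (fun t ht => (hY.deriv 0 t ht).sub (hZ.deriv t)) (by simp only [hY.init, hZ.init]; exact sub_self _)
    (fun t ht => by
      have e : (A t + (0 : ℝ) • K) * Y 0 t - A t ∘L fundamentalSolution A t
          = A t * (Y 0 t - fundamentalSolution A t) := by
        rw [zero_smul ℝ K, add_zero, mul_sub]; rfl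
      rw [e, add_zero]
      refine (norm_mul_le _ _).trans ?_
      gcongr
      linarith [ha t ht]) T ⟨hT, le_rfl⟩
  rw [zero_mul, norm_le_zero_iff, sub_eq_zero] at this
  exact this

/-- The characteristic determinant has a zero in `(0, 1)`. -/
theorem exists_characteristic_zero {N : ℕ} {A : ℝ → RN N →L[ℝ] RN N} (hA : Continuous A)
    {K : RN N →L[ℝ] RN N} {T : ℝ} (hT : 0 ≤ T) (hnd : (1 : ℂ) ∉ floquetMultipliers A T)
    (hodd : Odd (numRealMultipliersGtOne A T)) {Y : ℝ → ℝ → RN N →L[ℝ] RN N}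
    (hY : IsFundamentalFamily A K T Y) :
    ∃ ω ∈ Ioo (0 : ℝ) 1, ∃ l : RN N, ‖l‖ = 1 ∧
      ∀ x, inner ℝ l ((1 - ω • Y (1 - ω) T) x) = 0 := by
  have hc : Continuous fun ω : ℝ => (1 - ω • Y (1 - ω) T).det := by
    have h1 : Continuous fun ω : ℝ => Y (1 - ω) T :=
      (hY.continuous_param hA hT).comp (by fun_prop)
    exact ContinuousLinearMap.continuous_det.comp (continuous_const.sub (continuous_id.smul h1))
  have h0 : (1 - (0 : ℝ) • Y (1 - 0) T).det = 1 := by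
    simp [ContinuousLinearMap.det]
  -- At `ω = 1` the parameter is `0`, so the gain disappears; this is why no choice of `K` helps.
  have h1 : (1 - (1 : ℝ) • Y (1 - 1) T).det < 0 := by
    rw [sub_self, one_smul, hY.eq_monodromy hA hT]
    exact det_one_sub_monodromy_neg hnd hodd
  obtain ⟨ω, hω, e⟩ := intermediate_value_Ioo' zero_le_one hc.continuousOn
    (show (0 : ℝ) ∈ Ioo _ _ from ⟨h1, by rw [h0]; exact one_pos⟩)
  obtain ⟨l, hl, h⟩ := exists_orthogonal_range_of_det_eq_zero (𝕜 := ℝ) e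
  exact ⟨ω, hω, l, hl, h⟩

/-- Write `ω^n = (ω/R)^n R^n` and apply Cauchy-Schwarz; the geometric series converges because `ω <
R`. Thus no invertibility at `ω` is needed. -/
theorem integral_norm_sq_genFun_le {N : ℕ} {T ω R : ℝ} (hT : 0 ≤ T) (hω : 0 ≤ ω) (hωR : ω < R)
    (M : ℕ) {g : ℝ → RN N} (hg : Continuous g) :
    ∫ t in (0 : ℝ)..T, ‖genFun T M ω g t‖ ^ 2
      ≤ (1 - (ω / R) ^ 2)⁻¹ * weightedSq T R M g := by
  have hR : 0 < R := hω.trans_lt hωR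
  have hq0 : 0 ≤ (ω / R) ^ 2 := by positivity
  have hq1 : (ω / R) ^ 2 < 1 := by
    have : ω / R < 1 := (div_lt_one hR).2 hωR
    have h0 : 0 ≤ ω / R := by positivity
    nlinarith
  rw [weightedSq, ← intervalIntegral.integral_const_mul]
  refine intervalIntegral.integral_mono_on hT
    (((continuous_genFun T M ω hg).norm.pow 2).intervalIntegrable _ _)
    (Continuous.intervalIntegrable (by fun_prop) _ _) fun t _ => ?_
  have h1 : ‖genFun T M ω g t‖
      ≤ ∑ n ∈ Finset.range M, (ω / R) ^ n * (R ^ n * ‖g (t + n * T)‖) := by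
    refine (norm_sum_le _ _).trans (Finset.sum_le_sum fun n _ => ?_)
    rw [norm_smul, norm_pow, Real.norm_of_nonneg hω, ← mul_assoc, ← mul_pow,
      div_mul_cancel₀ _ hR.ne']
  have h2 := Finset.sum_mul_sq_le_sq_mul_sq (Finset.range M) (fun n => (ω / R) ^ n)
    (fun n => R ^ n * ‖g (t + n * T)‖)
  have h3 : ∑ n ∈ Finset.range M, ((ω / R) ^ n) ^ 2 ≤ (1 - (ω / R) ^ 2)⁻¹ := by
    rw [← tsum_geometric_of_lt_one hq0 hq1]
    simp only [← pow_mul, mul_comm _ 2]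
    simp only [pow_mul]
    exact (summable_geometric_of_lt_one hq0 hq1).sum_le_tsum _ fun n _ => by positivity
  calc ‖genFun T M ω g t‖ ^ 2
      ≤ (∑ n ∈ Finset.range M, (ω / R) ^ n * (R ^ n * ‖g (t + n * T)‖)) ^ 2 := by gcongr
    _ ≤ _ := h2
    _ ≤ (1 - (ω / R) ^ 2)⁻¹ * ∑ n ∈ Finset.range M, (R ^ n * ‖g (t + n * T)‖) ^ 2 := by
      gcongr
    _ = _ := by
      congr 1
      refine Finset.sum_congr rfl fun n _ => ?_
      rw [mul_pow, ← pow_mul, mul_comm n 2]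

theorem weightedSq_le_of_norm_le {E : Type*} [NormedAddCommGroup E] {T R η : ℝ} (hT : 0 ≤ T)
    (hR : 0 ≤ R) {M : ℕ} {y g : ℝ → E} (hyc : Continuous y) (hg : Continuous g)
    (h : ∀ t ∈ Icc 0 (M * T), ‖g t‖ ≤ η * ‖y t‖) :
    weightedSq T R M g ≤ η ^ 2 * weightedSq T R M y := by
  rw [weightedSq, weightedSq, ← intervalIntegral.integral_const_mul]
  refine intervalIntegral.integral_mono_on hT (Continuous.intervalIntegrable (by fun_prop) _ _)
    (Continuous.intervalIntegrable (by fun_prop) _ _) fun t ht => ?_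
  rw [Finset.mul_sum]
  refine Finset.sum_le_sum fun n hn => ?_
  have h1 : (n : ℝ) + 1 ≤ M := by exact_mod_cast Finset.mem_range.1 hn
  have := h (t + n * T) ⟨by have := ht.1; positivity, by nlinarith [ht.2]⟩
  calc R ^ (2 * n) * ‖g (t + n * T)‖ ^ 2 ≤ R ^ (2 * n) * (η * ‖y (t + n * T)‖) ^ 2 := by gcongr
    _ = _ := by ring

theorem integral_exp_sq_le {T m : ℝ} (hm : 0 < m) :
    ∫ t in (0 : ℝ)..T, Real.exp (m * (t - T)) ^ 2 ≤ (2 * m)⁻¹ := by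
  have h : ∀ t ∈ uIcc 0 T, HasDerivAt (fun t => Real.exp (2 * m * (t - T)) / (2 * m))
      (Real.exp (m * (t - T)) ^ 2) t := by
    intro t _
    have := ((((hasDerivAt_id t).sub_const T).const_mul (2 * m)).exp).div_const (2 * m)
    refine this.congr_deriv ?_
    rw [← Real.exp_nat_mul]
    simp only [id]
    field_simp
    congr 1; push_cast; ring
  rw [intervalIntegral.integral_eq_sub_of_hasDerivAt h
    (Continuous.intervalIntegrable (by fun_prop) _ _)]
  have := Real.exp_nonneg (2 * m * (0 - T))
  rw [sub_self, mul_zero, Real.exp_zero, ← sub_div, inv_eq_one_div]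
  gcongr
  linarith

/-- The bound of `integral_norm_sq_genForcing_le` leaves a fixed multiple of `σ²`, too large to
compare with `y(0) = σ l`. The exponential history gives `σ² / (2m)` instead, small relative to `σ²`
for large `m`. -/
theorem integral_norm_sq_genForcing_le_of_exp {N : ℕ} (K : RN N →L[ℝ] RN N) {T σ m δ ω : ℝ}
    (hT : 0 < T) (hm : 0 < m) (hω : 0 ≤ ω) {M : ℕ} {y g : ℝ → RN N} (hyc : Continuous y)
    (hg : Continuous g) (h1 : ∀ t ∈ Icc (-T) 0, ‖y t‖ ≤ σ * Real.exp (m * t))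
    (h2 : ∀ t ∈ Icc (M * T - T) (M * T), ω ^ M * ‖y t‖ ≤ δ) :
    ∫ s in (0 : ℝ)..T, ‖genForcing K T M ω y g s‖ ^ 2
      ≤ 3 * (∫ s in (0 : ℝ)..T, ‖genFun T M ω g s‖ ^ 2)
        + 3 * ‖K‖ ^ 2 * (σ ^ 2 * (2 * m)⁻¹ + T * δ ^ 2) := by
  have c1 := continuous_genForcing K T M ω hyc hg
  have c2 := continuous_genFun T M ω hg
  have hle : ∀ s ∈ Icc 0 T, ‖genForcing K T M ω y g s‖ ^ 2
      ≤ 3 * ‖genFun T M ω g s‖ ^ 2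
        + 3 * ‖K‖ ^ 2 * (σ ^ 2 * Real.exp (m * (s - T)) ^ 2 + δ ^ 2) := by
    intro s hs
    set a := ‖genFun T M ω g s‖
    set b := ‖K‖ * (σ * Real.exp (m * (s - T)))
    set d := ‖K‖ * δ
    have e1 : ‖K (y (s - T))‖ ≤ b := (K.le_opNorm _).trans
      (mul_le_mul_of_nonneg_left (h1 _ ⟨by linarith [hs.1], by linarith [hs.2]⟩) (norm_nonneg _))
    have e2 : ‖ω ^ M • K (y (s - T + M * T))‖ ≤ d := by
      rw [norm_smul, norm_pow, Real.norm_of_nonneg hω]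
      calc ω ^ M * ‖K (y (s - T + M * T))‖ ≤ ω ^ M * (‖K‖ * ‖y (s - T + M * T)‖) := by
            gcongr; exact K.le_opNorm _
        _ = ‖K‖ * (ω ^ M * ‖y (s - T + M * T)‖) := by ring
        _ ≤ _ := mul_le_mul_of_nonneg_left
            (h2 _ ⟨by linarith [hs.1], by linarith [hs.2]⟩) (norm_nonneg _)
    have e3 : ‖genForcing K T M ω y g s‖ ≤ a + b + d := by
      rw [genForcing]
      refine (norm_add_le _ _).trans ?_
      have := norm_sub_le (genFun T M ω g s) (K (y (s - T)))
      linarith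
    calc ‖genForcing K T M ω y g s‖ ^ 2 ≤ (a + b + d) ^ 2 := by gcongr
      _ ≤ 3 * a ^ 2 + 3 * b ^ 2 + 3 * d ^ 2 := by
        nlinarith [sq_nonneg (a - b), sq_nonneg (b - d), sq_nonneg (a - d)]
      _ = _ := by simp only [b, d]; ring
  calc _ ≤ ∫ s in (0 : ℝ)..T, (3 * ‖genFun T M ω g s‖ ^ 2
        + 3 * ‖K‖ ^ 2 * (σ ^ 2 * Real.exp (m * (s - T)) ^ 2 + δ ^ 2)) :=
        intervalIntegral.integral_mono_on hT.le ((c1.norm.pow 2).intervalIntegrable _ _)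
          (Continuous.intervalIntegrable (by fun_prop) _ _) hle
    _ = 3 * (∫ s in (0 : ℝ)..T, ‖genFun T M ω g s‖ ^ 2)
        + 3 * ‖K‖ ^ 2 * (σ ^ 2 * (∫ s in (0 : ℝ)..T, Real.exp (m * (s - T)) ^ 2) + T * δ ^ 2) := by
      rw [intervalIntegral.integral_add (Continuous.intervalIntegrable (by fun_prop) _ _)
        (Continuous.intervalIntegrable (by fun_prop) _ _), intervalIntegral.integral_const_mul,
        intervalIntegral.integral_const_mul,
        intervalIntegral.integral_add (Continuous.intervalIntegrable (by fun_prop) _ _)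
        (Continuous.intervalIntegrable (by fun_prop) _ _), intervalIntegral.integral_const_mul,
        intervalIntegral.integral_const]
      simp
    _ ≤ _ := by
      gcongr
      exact integral_exp_sq_le hm

theorem exists_pos_sq_mul_le {D : ℝ} (hD : 0 ≤ D) :
    ∃ η : ℝ, 0 < η ∧ η ≤ 1 / 4 ∧ η ^ 2 * D ≤ 1 / 16 := by
  refine ⟨1 / (4 * (D + 1)), by positivity, ?_, ?_⟩
  · rw [div_le_div_iff₀ (by positivity) (by norm_num)]
    linarith
  · rw [div_pow, one_pow, div_mul_eq_mul_div, one_mul, div_le_div_iff₀ (by positivity)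
      (by norm_num)]
    nlinarith

/-! ### The contradiction for bounded solutions. -/

set_option maxHeartbeats 1000000 in
/-- If the characteristic determinant of the delay equation has a zero in `(0, 1)`, then solutions
of small nonlinear perturbations with suitable initial histories cannot stay bounded. -/
theorem exists_unbounded_direction {N : ℕ} {A : ℝ → RN N →L[ℝ] RN N} (hA : Continuous A)
    (K : RN N →L[ℝ] RN N) {T : ℝ} (hT : 0 < T) (hper : ∀ t, A (t + T) = A t)
    (hnd : (1 : ℂ) ∉ floquetMultipliers A T) (hodd : Odd (numRealMultipliersGtOne A T)) :
    ∃ η > 0, ∃ m > 0, ∃ l : RN N, ‖l‖ = 1 ∧ ∀ σ > 0, ∀ ε > 0, ∃ M : ℕ, ∀ y g : ℝ → RN N,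
      Continuous y → Continuous g →
      (∀ t ∈ Ioo 0 (M * T), HasDerivAt y (A t (y t) + K (y t - y (t - T)) + g t) t) →
      (∀ t ∈ Icc (-T) 0, y t = (σ * Real.exp (m * t)) • l) →
      (∀ t ∈ Icc 0 (M * T), ‖y t‖ ≤ ε) → (∀ t ∈ Icc 0 (M * T), ‖g t‖ ≤ η * ‖y t‖) → False := by
  obtain ⟨Y, hY⟩ := exists_isFundamentalFamily (𝕜 := ℝ) hA hT.le K
  obtain ⟨ω, hω, l, hl, hlS⟩ := exists_characteristic_zero hA hT.le hnd hodd hY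
  obtain ⟨R, hR, C, hC0, hC⟩ := exists_weightedSq_bound_real hA K hT hper hω.1.le hω.2 le_rfl
  have hR0 : 0 < R := hω.1.trans hR.1
  obtain ⟨α, hα⟩ := (isCompact_Icc (a := 0) (b := T)).exists_bound_of_continuousOn hA.continuousOn
  have hα0 : 0 ≤ α := (norm_nonneg _).trans (hα 0 ⟨le_rfl, hT.le⟩)
  set c : ℝ := α + ‖K‖ with hc
  have hc0 : 0 ≤ c := by positivity
  have hcb : ∀ t ∈ Icc 0 T, ‖A t + (1 - ω) • K‖ ≤ c := fun t ht => by
    refine (norm_add_le _ _).trans (add_le_add (hα t ht) ?_)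
    rw [norm_smul, Real.norm_of_nonneg (by linarith [hω.2])]
    exact mul_le_of_le_one_left (norm_nonneg _) (by linarith [hω.1])
  set s : ℝ := Real.exp ((2 * c + 1) * T) with hs
  have hs0 : 0 ≤ s := Real.exp_nonneg _
  set C3 : ℝ := (1 - (ω / R) ^ 2)⁻¹ with hC3
  have hC30 : 0 ≤ C3 := by
    have h0 : 0 ≤ ω / R := div_nonneg hω.1.le hR0.le
    have h1 : ω / R < 1 := (div_lt_one hR0).2 hR.1
    rw [hC3]
    exact inv_nonneg.2 (by nlinarith)
  -- The first summand allows the weighted square of `g` to be absorbed, the second bounds its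
  -- effect at `ω`. Like `m` and `τ` below, `η` is independent of `σ` and `ε`; each of the three
  -- keeps one contribution to `‖z‖²` below `σ² / 16`.
  obtain ⟨η, hη0, hη⟩ : ∃ η : ℝ, 0 < η ∧ η ^ 2 * (C + 6 * s * C3 * C) ≤ 1 / 16 := by
    obtain ⟨η, h1, -, h2⟩ := exists_pos_sq_mul_le (show 0 ≤ C + 6 * s * C3 * C by positivity)
    exact ⟨η, h1, h2⟩
  have hη1 : C * η ^ 2 ≤ 1 / 2 := by
    have : 0 ≤ η ^ 2 * (6 * s * C3 * C) := by positivity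
    nlinarith
  have hη2 : s * (3 * C3 * η ^ 2 * (2 * C)) ≤ 1 / 16 := by
    have : 0 ≤ η ^ 2 * C := by positivity
    nlinarith
  obtain ⟨m, hm0, hm⟩ : ∃ m : ℝ, 0 < m ∧ s * (3 * ‖K‖ ^ 2) * (2 * m)⁻¹ ≤ 1 / 16 := by
    have hD : 0 ≤ s * (3 * ‖K‖ ^ 2) := by positivity
    refine ⟨8 * (s * (3 * ‖K‖ ^ 2) + 1), by positivity, ?_⟩
    rw [← div_eq_mul_inv, div_le_div_iff₀ (by positivity) (by norm_num)]
    linarith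
  obtain ⟨τ, hτ0, hτ1, hτ⟩ : ∃ τ : ℝ, 0 < τ ∧ τ ≤ 1 / 4 ∧ s * (3 * ‖K‖ ^ 2) * (T * τ ^ 2) ≤ 1 / 16 := by
    obtain ⟨τ, h1, h2, h3⟩ := exists_pos_sq_mul_le (show 0 ≤ s * (3 * ‖K‖ ^ 2) * T by positivity)
    exact ⟨τ, h1, h2, by rw [← mul_assoc, mul_comm]; exact h3⟩
  refine ⟨η, hη0, m, hm0, l, hl, fun σ hσ ε hε => ?_⟩
  -- Only the number of periods depends on `σ` and `ε`: it makes the last period negligible on the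
  -- scale `σ`. The extra period ensures `M ≠ 0` and keeps the last period inside `[0, MT]`.
  obtain ⟨M₀, hM₀⟩ := exists_pow_lt_of_lt_one (show 0 < τ * σ / ε by positivity) hR.2
  have hM0 : M₀ + 1 ≠ 0 := Nat.succ_ne_zero _
  have hRM : R ^ (M₀ + 1) * ε ≤ τ * σ := by
    rw [lt_div_iff₀ hε] at hM₀
    refine le_trans ?_ hM₀.le
    gcongr ?_ * ε
    exact pow_le_pow_of_le_one hR0.le hR.2.le (Nat.le_succ _)
  set M := M₀ + 1
  refine ⟨M, fun y g hyc hg hy hhist hbd hgbd => ?_⟩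
  have hMT : T ≤ M * T := by
    have : (1 : ℝ) ≤ M := by exact_mod_cast Nat.one_le_iff_ne_zero.2 hM0
    nlinarith
  have h1 : ∀ t ∈ Icc (-T) 0, ‖y t‖ ≤ σ * Real.exp (m * t) := fun t ht => by
    rw [hhist t ht, norm_smul, hl, mul_one, Real.norm_of_nonneg (by positivity)]
  have h1' : ∀ t ∈ Icc (-T) 0, ‖y t‖ ≤ σ := fun t ht => by
    refine (h1 t ht).trans (mul_le_of_le_one_right hσ.le (Real.exp_le_one_iff.2 ?_))
    exact mul_nonpos_of_nonneg_of_nonpos hm0.le ht.2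
  have h2 : ∀ t ∈ Icc (M * T - T) (M * T), R ^ M * ‖y t‖ ≤ τ * σ := fun t ht => by
    refine le_trans ?_ hRM
    gcongr
    exact hbd t ⟨by linarith [ht.1], ht.2⟩
  have h3 : ∀ t ∈ Icc (M * T - T) (M * T), ω ^ M * ‖y t‖ ≤ τ * σ := fun t ht => by
    refine le_trans ?_ (h2 t ht)
    have := hω.1
    have := hR.1.le
    gcongr
  have hQ := hC M y g σ hM0 hyc hg hy h1' (fun t ht => (h2 t ht).trans (by nlinarith))
  have hG := weightedSq_le_of_norm_le hT.le hR0.le hyc hg hgbd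
  have hQ0 : 0 ≤ weightedSq T R M y := intervalIntegral.integral_nonneg hT.le fun t _ =>
    Finset.sum_nonneg fun n _ => by positivity
  -- Since `C η² ≤ 1/2`, the contribution of `g` moves to the left side.
  have hQ' : weightedSq T R M y ≤ 2 * C * σ ^ 2 := by
    have e1 := mul_le_mul_of_nonneg_left hG hC0
    have e2 := mul_le_mul_of_nonneg_right hη1 hQ0
    nlinarith
  have hGω : ∫ t in (0 : ℝ)..T, ‖genFun T M ω g t‖ ^ 2 ≤ C3 * (η ^ 2 * (2 * C * σ ^ 2)) := by
    refine (integral_norm_sq_genFun_le hT.le hω.1.le hR.1 M hg).trans ?_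
    refine mul_le_mul_of_nonneg_left (hG.trans ?_) hC30
    gcongr
  have hI := integral_norm_sq_genForcing_le_of_exp K hT hm0 hω.1.le hyc hg h1 h3
  obtain ⟨hZ, hx0⟩ := genFun_sub_fundamental hT hper ω hyc hg hy hY hc0 hcb
  have hZT := hZ T ⟨hT.le, le_rfl⟩
  set z := genFun T M ω y T - Y (1 - ω) T (genFun T M ω y 0)
  have hz2 : ‖z‖ ^ 2 ≤ (σ / 2) ^ 2 := by
    calc ‖z‖ ^ 2 ≤ s * _ := hZT
      _ ≤ s * (3 * (C3 * (η ^ 2 * (2 * C * σ ^ 2)))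
          + 3 * ‖K‖ ^ 2 * (σ ^ 2 * (2 * m)⁻¹ + T * (τ * σ) ^ 2)) := by
        refine mul_le_mul_of_nonneg_left (hI.trans ?_) hs0
        gcongr
      _ = (s * (3 * C3 * η ^ 2 * (2 * C)) + s * (3 * ‖K‖ ^ 2) * (2 * m)⁻¹
          + s * (3 * ‖K‖ ^ 2) * (T * τ ^ 2)) * σ ^ 2 := by ring
      _ ≤ (1 / 16 + 1 / 16 + 1 / 16) * σ ^ 2 := by gcongr
      _ ≤ (σ / 2) ^ 2 := by rw [div_pow]; linarith [sq_nonneg σ]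
  have hz : ‖z‖ ≤ σ / 2 := le_of_sq_le_sq hz2 (by positivity)
  -- The pairing reads `0 = σ - ω^M ⟨l, y(MT)⟩ + ω ⟨l, z⟩`, whose right side is at least `σ - σ/4 -
  -- σ/2 > 0`.
  have h0 := hlS (genFun T M ω y 0)
  rw [hx0, hhist 0 ⟨by linarith, le_rfl⟩, inner_add_right, inner_sub_right, inner_smul_right,
    inner_smul_right, real_inner_self_eq_norm_sq, hl, mul_zero, Real.exp_zero] at h0
  have b1 : inner ℝ l (ω ^ M • y (M * T)) ≤ τ * σ := by
    refine (real_inner_le_norm _ _).trans ?_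
    rw [hl, one_mul, norm_smul, norm_pow, Real.norm_of_nonneg hω.1.le]
    exact h3 _ ⟨by linarith, le_rfl⟩
  have b2 : -(ω * inner ℝ l z) ≤ σ / 2 := by
    have e1 := abs_le.1 (abs_real_inner_le_norm l z)
    rw [hl, one_mul] at e1
    have e2 := mul_le_mul_of_nonneg_left e1.1 hω.1.le
    have e3 := mul_le_of_le_one_left (norm_nonneg z) hω.2.le
    linarith
  rw [inner_smul_right] at b1 h0
  have b3 := mul_le_mul_of_nonneg_right hτ1 hσ.le
  linarith

/-! ### Truncation and the method of steps. -/

/-- The radial retraction onto the closed ball of radius `ε`. -/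
noncomputable def radialRetraction {E : Type*} [NormedAddCommGroup E] [NormedSpace ℝ E] (ε : ℝ)
    (x : E) : E :=
  (ε / max ε ‖x‖) • x

section RadialRetraction

variable {E : Type*} [NormedAddCommGroup E] [NormedSpace ℝ E] {ε : ℝ}

theorem radialRetraction_of_norm_le (hε : 0 < ε) {x : E} (hx : ‖x‖ ≤ ε) :
    radialRetraction ε x = x := by
  rw [radialRetraction, max_eq_left hx, div_self hε.ne', one_smul]

theorem norm_radialRetraction_le (hε : 0 < ε) (x : E) : ‖radialRetraction ε x‖ ≤ ε := by
  have hm : 0 < max ε ‖x‖ := lt_max_of_lt_left hε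
  rw [radialRetraction, norm_smul, Real.norm_of_nonneg (by positivity), div_mul_eq_mul_div,
    div_le_iff₀ hm]
  gcongr
  exact le_max_right _ _

theorem continuous_radialRetraction (hε : 0 < ε) : Continuous (radialRetraction (E := E) ε) := by
  unfold radialRetraction
  have h : ∀ x : E, max ε ‖x‖ ≠ 0 := fun x => (lt_max_of_lt_left hε).ne'
  exact (continuous_const.div (by fun_prop) h).smul continuous_id

/-- One `‖x - y‖` comes from the vectors, the other from the change of the scaling factor.
Truncating with this map makes a `C¹` field globally Lipschitz in the state, which excludes blow-up.
-/
theorem norm_radialRetraction_sub_le (hε : 0 < ε) (x y : E) :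
    ‖radialRetraction ε x - radialRetraction ε y‖ ≤ 2 * ‖x - y‖ := by
  set a := max ε ‖x‖ with ha
  set b := max ε ‖y‖ with hb
  have ha0 : 0 < a := lt_max_of_lt_left hε
  have hb0 : 0 < b := lt_max_of_lt_left hε
  have hεa : ε ≤ a := le_max_left _ _
  have hyb : ‖y‖ ≤ b := le_max_right _ _
  have hab : |b - a| ≤ ‖x - y‖ := by
    have h1 := abs_max_sub_max_le_abs ‖y‖ ‖x‖ ε
    rw [max_comm, max_comm ‖x‖] at h1
    refine h1.trans ?_
    rw [norm_sub_rev]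
    exact abs_norm_sub_norm_le y x
  have e : radialRetraction ε x - radialRetraction ε y
      = (ε / a) • (x - y) + (ε / a * ((b - a) / b)) • y := by
    have : ε / a * ((b - a) / b) = ε / a - ε / b := by field_simp
    rw [this, radialRetraction, radialRetraction, smul_sub, sub_smul]
    abel
  have h1 : ε / a ≤ 1 := (div_le_one ha0).2 hεa
  have h0 : 0 ≤ ε / a := by positivity
  have h2 : ‖(ε / a) • (x - y)‖ ≤ ‖x - y‖ := by
    rw [norm_smul, Real.norm_of_nonneg h0]
    exact mul_le_of_le_one_left (norm_nonneg _) h1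
  have h3 : ‖(ε / a * ((b - a) / b)) • y‖ ≤ ‖x - y‖ := by
    rw [norm_smul, norm_mul, Real.norm_of_nonneg h0, norm_div, Real.norm_of_nonneg hb0.le,
      Real.norm_eq_abs]
    calc ε / a * (|b - a| / b) * ‖y‖ ≤ 1 * (|b - a| / b) * b := by gcongr
      _ = |b - a| := by field_simp
      _ ≤ _ := hab
  rw [e]
  refine (norm_add_le _ _).trans ?_
  linarith

end RadialRetraction

/-- The method of steps for a delay equation with Lipschitz right-hand side. -/
theorem exists_delay_solution {F : Type*} [NormedAddCommGroup F] [NormedSpace ℝ F]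
    [CompleteSpace F] {v : ℝ → F → F} (hv : Continuous (Function.uncurry v))
    (hlip : ∀ b, ∃ L, 0 ≤ L ∧ ∀ t ∈ Icc 0 b, ∀ x y, ‖v t x - v t y‖ ≤ L * ‖x - y‖)
    (K : F →L[ℝ] F) {T : ℝ} (hT : 0 < T) {φ : ℝ → F} (hφ : Continuous φ) (n : ℕ) :
    ∃ y : ℝ → F, Continuous y ∧ (∀ t ≤ 0, y t = φ t) ∧
      -- The history need not match the equation at `0`, so only a right derivative exists there; it
      -- is what the uniqueness theorem in the induction needs.
      (∀ t ∈ Ico 0 (n * T), HasDerivWithinAt y (v t (y t) - K (y (t - T))) (Ici t) t) ∧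
      ∀ t ∈ Ioo 0 (n * T), HasDerivAt y (v t (y t) - K (y (t - T))) t := by
  induction n with
  | zero => exact ⟨φ, hφ, fun _ _ => rfl, by simp, by simp⟩
  | succ n ih =>
    obtain ⟨y, hyc, hy0, hyr, hy⟩ := ih
    have hb : (0 : ℝ) ≤ (n + 1 : ℕ) * T := by positivity
    obtain ⟨L, hL0, hL⟩ := hlip ((n + 1 : ℕ) * T)
    have hL' : ∀ t ∈ Icc 0 ((n + 1 : ℕ) * T), ∀ x z,
        ‖(v t x - K (y (t - T))) - (v t z - K (y (t - T)))‖ ≤ L * ‖x - z‖ := fun t ht x z => by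
      rw [sub_sub_sub_cancel_right]; exact hL t ht x z
    have hyd : Continuous fun t => K (y (t - T)) := by fun_prop
    -- The equation is solved again from `0`, with the known `y` as delayed argument. Uniqueness
    -- identifies `z` with `y` on the earlier steps, so no derivatives have to be matched at `nT`.
    obtain ⟨z, hzc, hz0, hz⟩ := exists_solution_of_lipschitz
      (v := fun t x => v t x - K (y (t - T))) (hv.sub (hyd.comp continuous_fst)) hb hL0 hL' (φ 0)
    have hnn : (n : ℝ) * T ≤ (n + 1 : ℕ) * T := by push_cast; nlinarith
    have heq : EqOn y z (Icc 0 (n * T)) := by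
      refine ODE_solution_unique_of_mem_Icc_right (K := L.toNNReal)
        (v := fun t x => v t x - K (y (t - T))) (s := fun _ => univ) (fun t ht => ?_)
        hyc.continuousOn hyr (fun _ _ => mem_univ _) hzc.continuousOn
        (fun t ht => (hz t ⟨ht.1, ht.2.le.trans hnn⟩).hasDerivWithinAt) (fun _ _ => mem_univ _)
        (by rw [hz0, hy0 0 le_rfl])
      refine LipschitzOnWith.of_dist_le_mul fun a _ c _ => ?_
      rw [dist_eq_norm, dist_eq_norm, Real.coe_toNNReal _ hL0]
      exact hL' t ⟨ht.1, ht.2.le.trans hnn⟩ a c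
    let u : ℝ → F := fun t => if t ≤ 0 then φ t else z t
    have hu0 : ∀ t ≤ 0, u t = φ t := fun t ht => if_pos ht
    have hu1 : ∀ t, 0 ≤ t → u t = z t := fun t ht => by
      rcases ht.eq_or_lt with rfl | h
      · rw [hu0 0 le_rfl, hz0]
      · exact if_neg h.not_ge
    have hdelay : ∀ t ∈ Ico 0 ((n + 1 : ℕ) * T), u (t - T) = y (t - T) := by
      intro t ht
      rcases le_total (t - T) 0 with h | h
      · rw [hu0 _ h, hy0 _ h]
      · have h2 := ht.2
        push_cast at h2
        rw [hu1 _ h, heq ⟨h, by linarith⟩]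
    refine ⟨u, ?_, hu0, fun t ht => ?_, fun t ht => ?_⟩
    · exact Continuous.if_le hφ hzc continuous_id continuous_const (by rintro x rfl; exact hz0.symm)
    · have h1 := hz t ⟨ht.1, ht.2.le⟩
      rw [hdelay t ht, hu1 t ht.1]
      exact h1.hasDerivWithinAt.congr (fun s hs => hu1 s (ht.1.trans hs)) (hu1 t ht.1)
    · have h1 := hz t ⟨ht.1.le, ht.2.le⟩
      rw [hdelay t ⟨ht.1.le, ht.2⟩, hu1 t ht.1.le]
      refine h1.congr_of_eventuallyEq ?_
      filter_upwards [lt_mem_nhds ht.1] with s hs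
      exact hu1 s hs.le

/-! ### Expansion of the vector field along the periodic orbit. -/

section PeriodicSystem

variable {N : ℕ} {f : RN N → ℝ → RN N} {T : ℝ} {xs : ℝ → RN N}

theorem hasFDerivAt_section (hf : ContDiff ℝ 1 (Function.uncurry f)) (x : RN N) (t : ℝ) :
    HasFDerivAt (fun x => f x t) (fderiv ℝ (fun x => f x t) x) x := by
  have h : Differentiable ℝ (Function.uncurry f) := hf.differentiable one_ne_zero
  exact (DifferentiableAt.comp (g := Function.uncurry f) (f := fun x => (x, t)) x
    (h (x, t)) (by fun_prop)).hasFDerivAt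

theorem continuous_fderiv_section (hf : ContDiff ℝ 1 (Function.uncurry f)) :
    Continuous fun p : RN N × ℝ => fderiv ℝ (fun x => f x p.2) p.1 := by
  have h : Differentiable ℝ (Function.uncurry f) := hf.differentiable one_ne_zero
  have e : (fun p : RN N × ℝ => fderiv ℝ (fun x => f x p.2) p.1)
      = fun p => (fderiv ℝ (Function.uncurry f) p).comp (ContinuousLinearMap.inl ℝ (RN N) ℝ) := by
    funext p
    exact (HasFDerivAt.comp (g := Function.uncurry f) (f := fun x => (x, p.2)) p.1
      (h p).hasFDerivAt (hasFDerivAt_prodMk_left p.1 p.2)).fderiv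
  rw [e]
  exact (hf.continuous_fderiv one_ne_zero).clm_comp continuous_const

theorem continuous_linearization (hf : ContDiff ℝ 1 (Function.uncurry f)) (hxs : Continuous xs) :
    Continuous (linearization f xs) :=
  (continuous_fderiv_section hf).comp (hxs.prodMk continuous_id)

theorem linearization_periodic (hper : ∀ x t, f x (t + T) = f x t)
    (hxsT : ∀ t, xs (t + T) = xs t) (t : ℝ) :
    linearization f xs (t + T) = linearization f xs t := by
  simp only [linearization, hper, hxsT]

/-- Uniform first-order expansion along a periodic solution. -/
theorem exists_remainder_bound (hf : ContDiff ℝ 1 (Function.uncurry f)) (hT : 0 < T)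
    (hper : ∀ x t, f x (t + T) = f x t) (hxsc : Continuous xs) (hxsT : ∀ t, xs (t + T) = xs t)
    {η : ℝ} (hη : 0 < η) :
    ∃ ε > 0, ∀ t, ∀ p : RN N, ‖p‖ ≤ ε →
      ‖f (xs t + p) t - f (xs t) t - linearization f xs t p‖ ≤ η * ‖p‖ := by
  let D : ℝ → RN N → RN N →L[ℝ] RN N := fun t p => fderiv ℝ (fun x => f x t) (xs t + p)
  have hD : Continuous fun q : RN N × ℝ => D q.2 q.1 :=
    (continuous_fderiv_section hf).comp
      (((hxsc.comp continuous_snd).add continuous_fst).prodMk continuous_snd)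
  have hDper : Function.Periodic D T := fun t => by
    funext p
    simp only [D, hper, hxsT]
  -- Compactness of one period makes the closeness of derivatives uniform in time; periodicity
  -- extends it to all `t`, and the mean value inequality gives the remainder.
  have hev : ∀ᶠ p in nhds (0 : RN N), ∀ t ∈ Icc 0 T, ‖D t p - D t 0‖ < η := by
    refine isCompact_Icc.eventually_forall_of_forall_eventually fun t _ => ?_
    have hc : Continuous fun q : RN N × ℝ => ‖D q.2 q.1 - D q.2 0‖ :=
      (hD.sub (hD.comp (continuous_const.prodMk continuous_snd))).norm
    exact hc.continuousAt.eventually_lt continuousAt_const (by simpa using hη)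
  obtain ⟨ε, hε, hball⟩ := Metric.eventually_nhds_iff_ball.1 hev
  refine ⟨ε / 2, by positivity, fun t p hp => ?_⟩
  have hbd : ∀ q ∈ Metric.closedBall (0 : RN N) (ε / 2), ‖D t q - D t 0‖ ≤ η := by
    intro q hq
    obtain ⟨s, hs, e⟩ := hDper.exists_mem_Ico₀ hT t
    rw [e]
    exact (hball q (Metric.closedBall_subset_ball (by linarith) hq) s ⟨hs.1, hs.2.le⟩).le
  have := Convex.norm_image_sub_le_of_norm_hasFDerivWithin_le' (𝕜 := ℝ)
    (f := fun q => f (xs t + q) t) (f' := D t) (φ := D t 0) (s := Metric.closedBall 0 (ε / 2))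
    (x := 0) (y := p)
    (fun q _ => by
      have h1 := (hasFDerivAt_section hf (xs t + q) t).comp q ((hasFDerivAt_id q).const_add (xs t))
      rw [ContinuousLinearMap.comp_id] at h1
      exact h1.hasFDerivWithinAt)
    hbd (convex_closedBall _ _) (Metric.mem_closedBall_self (by positivity)) (by simpa using hp)
  simpa [D, linearization] using this

theorem exists_truncated_lipschitz (hf : ContDiff ℝ 1 (Function.uncurry f)) (hxsc : Continuous xs)
    {ε : ℝ} (hε : 0 < ε) (b : ℝ) :
    ∃ L, 0 ≤ L ∧ ∀ t ∈ Icc 0 b, ∀ p q : RN N,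
      ‖f (xs t + radialRetraction ε p) t - f (xs t + radialRetraction ε q) t‖ ≤ L * ‖p - q‖ := by
  have hD : Continuous fun q : RN N × ℝ => fderiv ℝ (fun x => f x q.2) (xs q.2 + q.1) :=
    (continuous_fderiv_section hf).comp
      (((hxsc.comp continuous_snd).add continuous_fst).prodMk continuous_snd)
  obtain ⟨L, hL⟩ := ((isCompact_closedBall (0 : RN N) ε).prod
    (isCompact_Icc (a := (0 : ℝ)) (b := b))).exists_bound_of_continuousOn hD.continuousOn
  refine ⟨max L 0 * 2, by positivity, fun t ht p q => ?_⟩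
  have hmem : ∀ p : RN N, radialRetraction ε p ∈ Metric.closedBall (0 : RN N) ε := fun p => by
    simpa using norm_radialRetraction_le hε p
  have := Convex.norm_image_sub_le_of_norm_hasFDerivWithin_le (𝕜 := ℝ)
    (f := fun q => f (xs t + q) t) (f' := fun q => fderiv ℝ (fun x => f x t) (xs t + q))
    (s := Metric.closedBall 0 ε) (C := max L 0)
    (fun q _ => by
      have h1 := (hasFDerivAt_section hf (xs t + q) t).comp q ((hasFDerivAt_id q).const_add (xs t))
      rw [ContinuousLinearMap.comp_id] at h1
      exact h1.hasFDerivWithinAt)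
    (fun q hq => (hL (q, t) ⟨hq, ht⟩).trans (le_max_left _ _)) (convex_closedBall _ _)
    (hmem q) (hmem p)
  refine this.trans ?_
  rw [mul_assoc]
  gcongr
  exact norm_radialRetraction_sub_le hε p q

end PeriodicSystem

/-! ### Instability of the controlled orbit. -/

theorem mainTheorem4 (N : ℕ) (f : RN N → ℝ → RN N)
    (hf : ContDiff ℝ 1 (Function.uncurry f))
    (T : ℝ) (hT : 0 < T)
    (hper : ∀ x t, f x (t + T) = f x t)
    (xs : ℝ → RN N)
    (hsol : ∀ t, HasDerivAt xs (f (xs t) t) t)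
    (hxs : ∀ t, xs (t + T) = xs t)
    (hnd : IsNondegenerate f T xs)
    (hodd : Odd (numRealMultipliersGtOne (linearization f xs) T))
    (K : Matrix (Fin N) (Fin N) ℝ) :
    IsPyragasUnstable f K T xs := by
  intro hstab
  have hxsc : Continuous xs := continuous_iff_continuousAt.2 fun t => (hsol t).continuousAt
  have hA := continuous_linearization hf hxsc
  set A := linearization f xs with hAdef
  set k : RN N →L[ℝ] RN N := Matrix.toEuclideanCLM (𝕜 := ℝ) K with hk
  obtain ⟨η, hη, m, hm, l, hl, hcore⟩ :=
    exists_unbounded_direction hA k hT (linearization_periodic hper hxs) hnd hodd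
  obtain ⟨ε, hε, hrem⟩ := exists_remainder_bound hf hT hper hxsc hxs hη
  -- The gap between `ε / 2` and `ε` drives a continuation argument: the deviation cannot reach the
  -- truncation level `ε`.
  obtain ⟨δ, hδ, hst⟩ := hstab (ε / 2) (by positivity)
  obtain ⟨σ, hσ, hσδ, hσε⟩ : ∃ σ > 0, σ < δ ∧ σ < ε :=
    ⟨min δ ε / 2, by positivity, by
      have := min_le_left δ ε
      linarith, by
      have := min_le_right δ ε
      linarith⟩
  obtain ⟨M, hM⟩ := hcore σ hσ ε hε
  have hfc : Continuous (Function.uncurry f) := hf.continuous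
  have hr := continuous_radialRetraction (E := RN N) hε
  have hFc : Continuous fun q : ℝ × RN N =>
      f (xs q.1 + radialRetraction ε q.2) q.1 - f (xs q.1) q.1 :=
    (hfc.comp (((hxsc.comp continuous_fst).add (hr.comp continuous_snd)).prodMk
      continuous_fst)).sub (hfc.comp ((hxsc.comp continuous_fst).prodMk continuous_fst))
  let v : ℝ → RN N → RN N := fun t p =>
    f (xs t + radialRetraction ε p) t - f (xs t) t + k p
  obtain ⟨y, hyc, hy0, -, hy⟩ := exists_delay_solution (v := v)
    (hFc.add (k.continuous.comp continuous_snd)) (fun b => by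
      obtain ⟨L, hL0, hL⟩ := exists_truncated_lipschitz hf hxsc hε b
      refine ⟨L + ‖k‖, by positivity, fun t ht p q => ?_⟩
      have e : v t p - v t q = (f (xs t + radialRetraction ε p) t
          - f (xs t + radialRetraction ε q) t) + k (p - q) := by
        simp only [v, map_sub]; abel
      rw [e, add_mul]
      exact (norm_add_le _ _).trans (add_le_add (hL t ht p q) (k.le_opNorm _)))
    k hT (φ := fun t => (σ * Real.exp (m * t)) • l) (by fun_prop) (M + 1)
  have hhist : ∀ t ≤ 0, ‖y t‖ ≤ σ := fun t ht => by
    rw [hy0 t ht, norm_smul, hl, mul_one, Real.norm_of_nonneg (by positivity)]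
    exact mul_le_of_le_one_right hσ.le
      (Real.exp_le_one_iff.2 (mul_nonpos_of_nonneg_of_nonpos hm.le ht))
  -- Below `ε` the truncation is inactive, and the control vanishes on the `T`-periodic orbit, so
  -- `xs + y` solves the original controlled system.
  have hsolution : ∀ b ≤ ((M + 1 : ℕ) : ℝ) * T, (∀ t ∈ Ioo 0 b, ‖y t‖ < ε) →
      IsPyragasSolution f K T b fun t => xs t + y t := by
    refine fun b hb hlt => ⟨(hxsc.add hyc).continuousOn, fun t ht => ?_⟩
    refine ((hsol t).add (hy t ⟨ht.1, ht.2.trans_le hb⟩)).congr_deriv ?_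
    have h1 : xs (t - T) = xs t := by rw [← hxs (t - T), sub_add_cancel]
    simp only [v, radialRetraction_of_norm_le hε (hlt t ht).le, h1, add_sub_add_left_eq_sub]
    rw [← hk, map_sub]
    abel
  have hsmall : ∀ b ∈ Ioc 0 (((M + 1 : ℕ) : ℝ) * T), (∀ t ∈ Ioo 0 b, ‖y t‖ < ε) →
      ∀ t ∈ Ico 0 b, ‖y t‖ < ε / 2 := by
    intro b hb hlt t ht
    have := hst b hb.1 _ (hsolution b hb.2 hlt) (fun θ hθ => by
      rw [add_sub_cancel_left]
      exact (hhist θ hθ.2).trans_lt hσδ) t ht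
    rwa [add_sub_cancel_left] at this
  have hstay : ∀ t ∈ Icc 0 (M * T), ‖y t‖ < ε := by
    intro t₁ ht₁
    by_contra! hge
    have hcpt : IsCompact (Icc 0 t₁ ∩ {t | ε ≤ ‖y t‖}) :=
      isCompact_Icc.inter_right (isClosed_le continuous_const hyc.norm)
    -- At the first time `τ` of reaching `ε`, stability gives `ε / 2` on `[0, τ)` and, by
    -- continuity, at `τ` too.
    obtain ⟨τ, ⟨⟨hτ0, hτ1⟩, hτε⟩, hτmin⟩ := hcpt.exists_isLeast ⟨t₁, ⟨ht₁.1, le_rfl⟩, hge⟩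
    have hτpos : 0 < τ := by
      rcases hτ0.eq_or_lt with rfl | h
      · exact absurd (hhist 0 le_rfl) (not_le.2 (hσε.trans_le hτε))
      · exact h
    have hlt : ∀ t ∈ Ioo 0 τ, ‖y t‖ < ε := fun t ht => by
      by_contra! h
      exact absurd (hτmin ⟨⟨ht.1.le, ht.2.le.trans hτ1⟩, h⟩) ht.2.not_ge
    have hb : τ ∈ Ioc 0 (((M + 1 : ℕ) : ℝ) * T) := by
      refine ⟨hτpos, hτ1.trans (ht₁.2.trans ?_)⟩
      push_cast; nlinarith
    have hcl : ‖y τ‖ ≤ ε / 2 := by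
      have hmem : τ ∈ closure (Ico 0 τ) := by
        rw [closure_Ico hτpos.ne]; exact ⟨hτ0, le_rfl⟩
      exact closure_minimal (fun t ht => (hsmall τ hb hlt t ht).le)
        (isClosed_le hyc.norm continuous_const) hmem
    have : ε ≤ ‖y τ‖ := hτε
    linarith
  let g : ℝ → RN N := fun t => f (xs t + radialRetraction ε (y t)) t - f (xs t) t - A t (y t)
  refine hM y g hyc ((hFc.comp (continuous_id.prodMk hyc)).sub (hA.clm_apply hyc))
    (fun t ht => ?_) (fun t ht => hy0 t ht.2) (fun t ht => (hstay t ht).le) (fun t ht => ?_)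
  · refine (hy t ⟨ht.1, ht.2.trans_le (by push_cast; nlinarith)⟩).congr_deriv ?_
    simp only [v, g, map_sub]
    abel
  · simp only [g, radialRetraction_of_norm_le hε (hstay t ht).le]
    exact hrem t (y t) (hstay t ht).le
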